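/- **Setting.** All graphs are simplicial (no loops, no multiple edges); they may be infinite. Let $\Theta$ be a connected graph without vertices of degree $1$, and let $f\colon\Omega\to\Theta$ be a graph homomorphism, where $\Omega$ is a (possibly disconnected) graph with connected components $\Omega_i$, such that every edge of $\Omega$ lies on an immersed cycle of $\Omega$ (an immersed cycle is a closed walk of positive length that, read cyclically, never backtracks). The graphical complex $X=X_{(\Omega,\Theta)}$ is the $2$-complex with $1$-skeleton $\Theta$ obtained by attaching, for each immersed cycle $C\to\Omega$, a $2$-cell along $C\to\Omega\to\Theta$. A *piece* of $X$ is an immersed path of positive length in $\Theta$ that has two distinct lifts to $\Omega$. $X$ satisfies $C(p)$ if for no immersed cycle $C\to\Omega$ the composition $C\to\Omega\to\Theta$ is a concatenation of fewer than $p$ pieces. A *disc diagram* is a combinatorial map $D\to X$, where $D$ is a (finite) combinatorial cell structure on $S^2$ with one $2$-cell removed; each $2$-cell $R$ of $D$ then maps to a $2$-cell of $X$ and so yields a lift $\partial R\to\Omega$ of its boundary to an immersed cycle. The diagram is *reduced* if, whenever a path $P\to D$ of positive length factors in two distinct ways through $2$-cells of $D$, the two resulting lifts $P\to\Omega$ are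 distinct (so that $P\to X$ is again a piece, as witnessed by these two lifts). $X$ satisfies $T(q)$ if no reduced disc diagram has an interior vertex whose degree is greater than $2$ and less than $q$. The *thickening* $\mathrm{Th}(X)$ is the flag completion of the graph obtained from $\Theta$ by making the vertices of (the image of) each $\Omega_i$ pairwise adjacent. Let $d$ be the graph metric on its $1$-skeleton. For vertices $u,v$ and $0\le k\le d(u,v)$, the level set $L_k(u,v)$ is the subgraph of the $1$-skeleton induced by the vertices $x$ with $d(u,x)=k$ and $d(x,v)=d(u,v)-k$. A graph is *bridged* if it is connected and all its isometric cycles have length $3$; a flag simplicial complex is *systolic* if its $1$-skeleton is bridged; a systolic complex is *fit* if there are $B,C>0$ such that every level set of every interval is $(B,C)$-quasi-isometric to a segment (a finite path). **Proposition.** Suppose that $X_{(\Omega,\Theta)}$ is simply connected and satisfies $C(3)$ and $T(6)$. Then for any vertices $u,v$ of $\mathrm{Th}(X_{(\Omega,\Theta)})$ and every $0\le k\le d(u,v)$, the level set $L_k(u,v)$ is a segment, i.e. a finite path with at least one vertex. In particular, $\mathrm{Th}(X_{(\Omega,\Theta)})$ is a fit systolic complex. -/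

import Mathlib

/-! ### Graphs: intervals, level sets, bridged graphs, segments -/

namespace SimpleGraph

variable {V : Type*}

/-- The interval `I(u,v)`: all vertices lying on shortest `(u,v)`-paths. -/
def interval (G : SimpleGraph V) (u v : V) : Set V :=
  {x | G.dist u x + G.dist x v = G.dist u v}

/-- The level `L_k(u,v)` of the interval `I(u,v)` (meant for `k ≤ d(u,v)`), as a vertex set;
as a graph it is `G.induce (G.levelSet u v k)`. -/
def levelSet (G : SimpleGraph V) (u v : V) (k : ℕ) : Set V :=
  {x | x ∈ G.interval u v ∧ G.dist u x = k ∧ G.dist x v = G.dist u v - k}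

/-- A connected graph is bridged if every isometric cycle in it has length `3`. -/
def IsBridged (G : SimpleGraph V) : Prop :=
  G.Connected ∧
    ∀ (n : ℕ) (c : Fin n → V), 3 ≤ n →
      (∀ i j, G.dist (c i) (c j) = (cycleGraph n).dist i j) → n = 3

/-- A segment: a finite path with at least one vertex. -/
def IsSegment {U : Type*} (H : SimpleGraph U) : Prop :=
  ∃ n : ℕ, Nonempty (H ≃g pathGraph (n + 1))

/-- `φ` is a `(B,C)`-quasi-isometry between (the vertex sets of) two graphs with their graph
metrics. -/
def IsQuasiIsometry {U U' : Type*} (H : SimpleGraph U) (H' : SimpleGraph U') (B C : ℝ)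
    (φ : U → U') : Prop :=
  (∀ y, ∃ x, (H'.dist (φ x) y : ℝ) ≤ C) ∧
    ∀ x x', B⁻¹ * (H.dist x x' : ℝ) - C ≤ (H'.dist (φ x) (φ x') : ℝ) ∧
      (H'.dist (φ x) (φ x') : ℝ) ≤ B * (H.dist x x' : ℝ) + C

/-- The flag completion of a graph: the simplices are the nonempty finite cliques. -/
def flagCompletion (G : SimpleGraph V) : AbstractSimplicialComplex V where
  faces := {s | s.Nonempty ∧ G.IsClique (s : Set V)}
  isRelLowerSet_faces := by
    rintro s ⟨hs, hc⟩
    exact ⟨hs, fun t hts ht => ⟨ht, hc.subset (by exact_mod_cast hts)⟩⟩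
  singleton_mem v := by simp

end SimpleGraph

/-! ### Systolic and fit complexes -/

namespace AbstractSimplicialComplex

variable {V : Type*}

/-- The `1`-skeleton: two distinct vertices are adjacent when they lie in a common simplex. -/
def oneSkeleton (K : AbstractSimplicialComplex V) : SimpleGraph V where
  Adj x y := x ≠ y ∧ ∃ s ∈ K.faces, x ∈ s ∧ y ∈ s
  symm := ⟨fun _ _ h => ⟨h.1.symm, h.2.imp fun _ hs => ⟨hs.1, hs.2.2, hs.2.1⟩⟩⟩
  loopless := ⟨fun _ h => h.1 rfl⟩

/-- A complex is flag if every nonempty finite clique of its `1`-skeleton spans a simplex. -/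
def IsFlag (K : AbstractSimplicialComplex V) : Prop :=
  ∀ s : Finset V, s.Nonempty → K.oneSkeleton.IsClique (s : Set V) → s ∈ K.faces

/-- A systolic complex: a flag simplicial complex whose `1`-skeleton is bridged. -/
def IsSystolic (K : AbstractSimplicialComplex V) : Prop :=
  K.IsFlag ∧ K.oneSkeleton.IsBridged

/-- A fit complex: a systolic complex all of whose levels (in all intervals) are quasi-isometric
to segments, with uniform constants. -/
def IsFit (K : AbstractSimplicialComplex V) : Prop :=
  K.IsSystolic ∧
    ∃ B C : ℝ, 0 < B ∧ 0 < C ∧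
      ∀ (u v : V) (k : ℕ), k ≤ K.oneSkeleton.dist u v →
        ∃ (n : ℕ) (φ : K.oneSkeleton.levelSet u v k → Fin (n + 1)),
          (K.oneSkeleton.induce (K.oneSkeleton.levelSet u v k)).IsQuasiIsometry
            (SimpleGraph.pathGraph (n + 1)) B C φ

end AbstractSimplicialComplex

/-! ### Graphical complexes

The data of a graphical complex is a homomorphism of simplicial graphs `f : Ω →g Θ`. The complex
`X_(Ω,Θ)` has `1`-skeleton `Θ` and one `2`-cell attached along `f ∘ c` for every immersed cycle `c`
of `Ω`. -/

namespace Graphical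

open SimpleGraph

variable {V W : Type*}

/-- A walk is immersed (locally injective) if it never backtracks. -/
def IsImmersed {G : SimpleGraph V} {u v : V} (p : G.Walk u v) : Prop :=
  p.darts.IsChain fun d e => e ≠ d.symm

/-- A closed walk, read cyclically, is an immersed cycle if it has positive length and it does not
backtrack, also not at its base point. -/
def IsImmersedCycle {G : SimpleGraph V} {v : V} (c : G.Walk v v) : Prop :=
  0 < c.length ∧ IsImmersed (c.append c)

section

variable {Θ : SimpleGraph V} {Ω : SimpleGraph W} (f : Ω →g Θ)

/-- Combinatorial homotopy (with fixed endpoints) of edge paths in the complex `X_(Ω,Θ)`: the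
equivalence relation generated by removing a backtrack and by removing the boundary cycle of a
`2`-cell. (The rotations and the reverse of an immersed cycle are again immersed cycles.) -/
inductive Homotopic : ∀ {u v : V}, Θ.Walk u v → Θ.Walk u v → Prop
  | refl {u v : V} (p : Θ.Walk u v) : Homotopic p p
  | symm {u v : V} {p q : Θ.Walk u v} : Homotopic p q → Homotopic q p
  | trans {u v : V} {p q r : Θ.Walk u v} : Homotopic p q → Homotopic q r → Homotopic p r
  | backtrack {u x y v : V} (p : Θ.Walk u x) (h : Θ.Adj x y) (q : Θ.Walk x v) :
      Homotopic (p.append (.cons h (.cons h.symm q))) (p.append q)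
  | cell {u v : V} {w : W} (c : Ω.Walk w w) (hc : IsImmersedCycle c)
      (p : Θ.Walk u (f w)) (q : Θ.Walk (f w) v) :
      Homotopic (p.append ((c.map f).append q)) (p.append q)

/-- `X_(Ω,Θ)` is simply connected: it is connected and every closed edge path is null-homotopic. -/
def IsSimplyConnected : Prop :=
  Θ.Connected ∧ ∀ (v : V) (p : Θ.Walk v v), Homotopic f p .nil

/-- A piece: a nontrivial immersed path in `Θ` with two distinct lifts to `Ω`. (In a simplicial
graph a path is determined by its sequence of vertices.) -/
def IsPiece {u v : V} (p : Θ.Walk u v) : Prop :=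
  0 < p.length ∧ IsImmersed p ∧
    ∃ (a b a' b' : W) (q : Ω.Walk a b) (q' : Ω.Walk a' b'),
      q.support.map f = p.support ∧ q'.support.map f = p.support ∧ q.support ≠ q'.support

/-- `IsConcatOfPieces f k p`: the path `p` is the concatenation of `k` pieces. -/
inductive IsConcatOfPieces : ∀ {u v : V}, ℕ → Θ.Walk u v → Prop
  | nil (u : V) : IsConcatOfPieces 0 (Walk.nil : Θ.Walk u u)
  | cons {u v w : V} {k : ℕ} (p : Θ.Walk u v) (q : Θ.Walk v w) :
      IsPiece f p → IsConcatOfPieces k q → IsConcatOfPieces (k + 1) (p.append q)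

/-- The `C(p)` condition: the image in `Θ` of an immersed cycle of `Ω` is never the concatenation
of fewer than `p` pieces. (The base point of the cycle is arbitrary.) -/
def SatisfiesC (p : ℕ) : Prop :=
  ¬ ∃ (w : W) (c : Ω.Walk w w), IsImmersedCycle c ∧ ∃ k < p, IsConcatOfPieces f k (c.map f)

end

/-- A finite combinatorial cell structure on the `2`-sphere (with at least one edge), encoded as a
combinatorial map on the set of its oriented edges (darts): `flip` reverses a dart, `rot` sends a
dart to the next dart with the same initial vertex in the cyclic order around that vertex.
The vertices, edges and faces are the orbits of `rot`, `flip` and `rot * flip`; `(rot * flip) d` is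
the dart following `d` on the boundary of the face to which `d` belongs. Every edge lies on the
boundary of the face of `d` and of the face of `flip d`. The surface is a sphere if and only if it
is connected and has Euler characteristic `2`. -/
structure SphereMap where
  /-- oriented edges -/
  Dart : Type
  finite : Finite Dart
  rot : Equiv.Perm Dart
  flip : Equiv.Perm Dart
  flip_flip : ∀ d, flip (flip d) = d
  flip_ne : ∀ d, flip d ≠ d
  connected : ∀ d e, ∃ g ∈ Subgroup.closure {rot, flip}, g d = e
  euler : Nat.card (Quotient (Equiv.Perm.SameCycle.setoid rot))
      + Nat.card (Quotient (Equiv.Perm.SameCycle.setoid (rot * flip)))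
    = Nat.card (Quotient (Equiv.Perm.SameCycle.setoid flip)) + 2

namespace SphereMap

variable (S : SphereMap)

/-- The next dart on the boundary of a face. -/
def next : Equiv.Perm S.Dart := S.rot * S.flip

/-- The degree of the initial vertex of a dart. -/
noncomputable def degree (d : S.Dart) : ℕ := Nat.card {e : S.Dart // S.rot.SameCycle d e}

end SphereMap

/-- A disc diagram `D → X_(Ω,Θ)`. Here `D` is a cell structure on the sphere with one `2`-cell (the
one with the dart `outer` on its boundary) removed. The combinatorial map is given on vertices by
`vert` (where `vert d` is the image of the initial vertex of the dart `d`) and sends each `2`-cell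
of `D` to a `2`-cell of `X_(Ω,Θ)`, hence its boundary cycle to an immersed cycle of `Ω` lifting it:
if `d` lies on the boundary of the `2`-cell `R`, then `lift d` is the vertex of `Ω` corresponding
to the initial vertex of `d` on `∂R`. (On the boundary of the removed cell `lift` has no meaning.) -/
structure DiscDiagram {Θ : SimpleGraph V} {Ω : SimpleGraph W} (f : Ω →g Θ) extends SphereMap where
  outer : Dart
  vert : Dart → V
  lift : Dart → W
  vert_rot : ∀ d, vert (rot d) = vert d
  vert_adj : ∀ d, Θ.Adj (vert d) (vert (flip d))
  map_lift : ∀ d, ¬ toSphereMap.next.SameCycle outer d → f (lift d) = vert d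
  lift_adj : ∀ d, ¬ toSphereMap.next.SameCycle outer d →
    Ω.Adj (lift d) (lift (toSphereMap.next d))
  lift_immersed : ∀ d, ¬ toSphereMap.next.SameCycle outer d →
    lift d ≠ lift (toSphereMap.next (toSphereMap.next d))

namespace DiscDiagram

variable {Θ : SimpleGraph V} {Ω : SimpleGraph W} {f : Ω →g Θ} (D : DiscDiagram f)

/-- The dart lies on the boundary of a `2`-cell of `D` (not of the removed one). -/
def IsInner (d : D.Dart) : Prop := ¬ D.next.SameCycle D.outer d

/-- The initial vertex of the dart `d` is an interior vertex of `D`. -/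
def IsInteriorVertex (d : D.Dart) : Prop := ∀ e, D.rot.SameCycle d e → D.IsInner e

/-- The diagram is reduced: whenever a path in `D` runs along two `2`-cells of `D` in two distinct
ways (a piece of the diagram), the two lifts to `Ω` that it gets from the two `2`-cells are
distinct, so that it maps to a piece of `X_(Ω,Θ)`. Pieces of a diagram contain pieces with a single
edge, and two lifts of a path differ if they differ on an edge; so this has to be required only for
single edges, that is, for the two sides `d` and `flip d` of an edge. -/
def IsReduced : Prop :=
  ∀ d, D.IsInner d → D.IsInner (D.flip d) →
    ¬ (D.lift d = D.lift (D.next (D.flip d)) ∧ D.lift (D.next d) = D.lift (D.flip d))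

end DiscDiagram

section

variable {Θ : SimpleGraph V} {Ω : SimpleGraph W} (f : Ω →g Θ)

/-- The `T(q)` condition: no reduced disc diagram has an interior vertex of degree greater than `2`
and less than `q`. -/
def SatisfiesT (q : ℕ) : Prop :=
  ∀ D : DiscDiagram f, D.IsReduced →
    ∀ d : D.Dart, D.IsInteriorVertex d → ¬ (2 < D.degree d ∧ D.degree d < q)

/-- The graph obtained from `Θ` by turning the (image of the) vertex set of each connected component
of `Ω` into a clique. -/
def thickGraph : SimpleGraph V where
  Adj x y := x ≠ y ∧ (Θ.Adj x y ∨
    ∃ i : Ω.ConnectedComponent, x ∈ f '' i.supp ∧ y ∈ f '' i.supp)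
  symm := ⟨fun _ _ h => ⟨h.1.symm, h.2.imp (fun h => h.symm) fun h => h.imp fun _ h => h.symm⟩⟩
  loopless := ⟨fun _ h => h.1 rfl⟩

/-- The thickening `Th(X_(Ω,Θ))`. -/
def thickening : AbstractSimplicialComplex V := (thickGraph f).flagCompletion

end

end Graphical

/-! The theorem is a local-to-global argument. Locally, consider the link of a vertex `v` of `Θ`:
its points are the edges at `v`, and every vertex `y` of `Ω` over `v` is a hyperedge consisting of
the edges at `v` that lift to `y`. A short closed chain of such hyperedges can be thickened to a
wheel: every edge of `Ω` lies on an immersed cycle, so every turn at `y` is made by some immersed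
cycle (`exists_periodic_turn`), and these cycles are the faces of a reduced disc diagram around one
interior vertex. `T(6)` forbids degrees 3, 4 and 5 there, so the links have girth at least six
(`linkGirthSix`).

Consequently the thickening, taken as a complex of arrows and triangles, is locally `6`-large: four
or five arrows in cyclic order in a link have a diagonal. Moreover two arrows adjacent in a link
determine one vertex of `Ω` at which both start, which gives the thinness condition `diamond`. At
this stage two arrows may still have the same ends, so the complex is a `TriangleComplex` and not a
simplicial complex.

Globally, the universal cover is built sphere by sphere. Arrows at a vertex of a sphere go down,
stay in the sphere or go up; the next sphere is the set of up arrows modulo having the same end, and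
local `6`-largeness makes this relation transitive (`Layer.Same.trans`) and lets the sphere axioms
pass to the next sphere (`Layer.next`). Cycles of `Ω` lift to closed paths of the cover, so simple
connectivity of `X` makes the covering map bijective (`bijective_pr`). The radius of a sphere is
then the graph distance, and the sphere axioms become the metric conditions of `IsThinSystolic`.

These conditions give the conclusion by elementary metric arguments. Isometric cycles of length
greater than three are contracted at the point farthest from a base point. In a level of an interval
there are no triangles and no vertices of degree three, connectedness and finiteness are inherited
from the level nearer to `v`, and an end of a level produces an end of the next one; hence a level
is a finite path. -/

namespace SimpleGraph

variable {V : Type*}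

/-! ### Distances in graphs and cycles; recognizing finite paths -/

theorem Connected.exists_adj_dist_add_one {G : SimpleGraph V} (hG : G.Connected) {u x : V}
    (h : G.dist u x ≠ 0) : ∃ y, G.Adj x y ∧ G.dist u y + 1 = G.dist u x := by
  obtain ⟨p, hp⟩ := hG.exists_walk_length_eq_dist x u
  cases p with
  | nil => simp at h
  | @cons _ y _ hxy q =>
    refine ⟨y, hxy, ?_⟩
    have h1 : G.dist y u ≤ q.length := dist_le q
    have h2 : G.dist u x ≤ G.dist u y + G.dist y x := hG.dist_triangle
    have h3 : G.dist y x = 1 := dist_eq_one_iff_adj.2 hxy.symm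
    rw [Walk.length_cons, dist_comm] at hp
    rw [dist_comm] at h1
    omega

theorem Connected.dist_le_succ_of_adj {G : SimpleGraph V} (hG : G.Connected) {u x y : V}
    (h : G.Adj x y) : G.dist u y ≤ G.dist u x + 1 := by
  have h2 : G.dist u y ≤ G.dist u x + G.dist x y := hG.dist_triangle
  rwa [dist_eq_one_iff_adj.2 h] at h2

theorem dist_le_of_lipschitz {G : SimpleGraph V} (hG : G.Connected) (φ : V → ℕ)
    (hφ : ∀ x y, G.Adj x y → φ y ≤ φ x + 1) (x y : V) : φ y ≤ φ x + G.dist x y := by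
  obtain ⟨p, hp⟩ := hG.exists_walk_length_eq_dist x y
  rw [← hp]
  clear hp
  induction p with
  | nil => simp
  | cons h p ih =>
    have := hφ _ _ h
    rw [Walk.length_cons]
    omega

theorem dist_cycleGraph_le {n : ℕ} (i j : Fin n) (hij : i ≤ j) :
    (cycleGraph n).dist i j ≤ j - i := by
  obtain _ | n := n
  · exact i.elim0
  obtain ⟨i, hi⟩ := i
  obtain ⟨j, hj⟩ := j
  obtain ⟨k, rfl⟩ := Nat.exists_eq_add_of_le (show i ≤ j from hij)
  induction k with
  | zero => simp
  | succ k ih =>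
    have hk : i + k < n + 1 := by omega
    have h1 := ih hk (by simp)
    have hadj : (cycleGraph (n + 1)).Adj ⟨i + k, hk⟩ ⟨i + (k + 1), hj⟩ :=
      pathGraph_le_cycleGraph (by rw [pathGraph_adj]; left; simp; omega)
    have h2 := cycleGraph_connected.dist_le_succ_of_adj (u := ⟨i, hi⟩) hadj
    simp only at h1 ⊢
    omega

theorem cycleGraph_adj_val {n : ℕ} (hn : 3 ≤ n) {i j : Fin n} (h : (cycleGraph n).Adj i j) :
    (i : ℕ) + 1 = j ∨ (j : ℕ) + 1 = i ∨ (i : ℕ) + (n - 1) = j ∨ (j : ℕ) + (n - 1) = i := by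
  rw [cycleGraph_adj'] at h
  have hi := i.2
  have hj := j.2
  rcases h with h | h
  · rcases le_total j i with hl | hl
    · rw [Fin.sub_val_of_le hl] at h; have := Fin.le_def.1 hl; omega
    · rcases hl.eq_or_lt with rfl | hl
      · rw [Fin.sub_val_of_le le_rfl] at h; omega
      · rw [Fin.coe_sub_iff_lt.2 hl] at h; have := Fin.lt_def.1 hl; omega
  · rcases le_total i j with hl | hl
    · rw [Fin.sub_val_of_le hl] at h; have := Fin.le_def.1 hl; omega
    · rcases hl.eq_or_lt with rfl | hl
      · rw [Fin.sub_val_of_le le_rfl] at h; omega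
      · rw [Fin.coe_sub_iff_lt.2 hl] at h; have := Fin.lt_def.1 hl; omega

theorem dist_cycleGraph {n : ℕ} (hn : 3 ≤ n) (i j : Fin n) (hij : i ≤ j) :
    (cycleGraph n).dist i j = min (j - i : ℕ) (n - (j - i)) := by
  obtain _ | n := n
  · exact i.elim0
  have hc : (cycleGraph (n + 1)).Connected := cycleGraph_connected
  have hi := i.2
  have hj := j.2
  have hij' := Fin.le_def.1 hij
  apply le_antisymm
  · refine le_min (dist_cycleGraph_le i j hij) ?_
    -- The other way round: from `i` down to `0`, across the edge between `0` and the last vertex,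
    -- then down to `j`.
    have h1 := dist_cycleGraph_le (0 : Fin (n + 1)) i (Fin.zero_le _)
    have h2 := dist_cycleGraph_le j (Fin.last n) (Fin.le_last _)
    have h3 : (cycleGraph (n + 1)).Adj 0 (Fin.last n) := by
      rw [cycleGraph_adj']
      left
      rw [Fin.coe_sub_iff_lt.2 (by rw [Fin.lt_def]; simp; omega)]
      simp
    have h4 := hc.dist_le_succ_of_adj (u := i) h3
    have h5 : (cycleGraph (n + 1)).dist i j ≤
      (cycleGraph (n + 1)).dist i (Fin.last n) + (cycleGraph (n + 1)).dist (Fin.last n) j :=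
      hc.dist_triangle
    rw [dist_comm (u := Fin.last n)] at h5
    rw [dist_comm (u := 0)] at h1
    simp only [Fin.val_zero, Fin.val_last] at h1 h2
    omega
  -- With truncated subtraction `(k - i) + (i - k)` is `|k - i|`. The resulting function vanishes at
  -- `i` and changes by at most one along each edge, including the edge that closes the cycle.
  · have := dist_le_of_lipschitz hc
      (fun k : Fin (n + 1) => min ((k : ℕ) - i + (i - k)) (n + 1 - (k - i + (i - k)))) (by
        intro x y hxy
        have := cycleGraph_adj_val hn hxy
        have := x.2
        have := y.2
        omega) i j
    omega

/-- The distance from the end `e` is a coordinate. It is injective by induction: if `x` and `y` have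
the same predecessor `x'`, then either `x' = e` has only one neighbour, or `x'` has a predecessor of
its own and room for only one more neighbour. Descending from a farthest vertex shows that all
smaller values occur. -/
theorem isSegment_of_degree_le_two {U : Type*} [Finite U] {H : SimpleGraph U} (hH : H.Connected)
    (hdeg : ∀ x a b c, H.Adj x a → H.Adj x b → H.Adj x c → a = b ∨ a = c ∨ b = c) (e : U)
    (he : ∀ a b, H.Adj e a → H.Adj e b → a = b) : H.IsSegment := by
  have hinj : ∀ k x y, H.dist e x = k → H.dist e y = k → x = y := by
    intro k
    induction k with
    | zero =>
      intro x y hx hy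
      rw [hH.dist_eq_zero_iff] at hx hy
      rw [← hx, ← hy]
    | succ k ih =>
      intro x y hx hy
      obtain ⟨x', hxx', hx'⟩ := hH.exists_adj_dist_add_one (u := e) (x := x) (by omega)
      obtain ⟨y', hyy', hy'⟩ := hH.exists_adj_dist_add_one (u := e) (x := y) (by omega)
      obtain rfl : x' = y' := ih _ _ (by omega) (by omega)
      rcases Nat.eq_zero_or_pos k with rfl | hk
      · have : e = x' := by rw [← hH.dist_eq_zero_iff]; omega
        subst this
        exact he _ _ hxx'.symm hyy'.symm
      · obtain ⟨z, hxz, hz⟩ := hH.exists_adj_dist_add_one (u := e) (x := x') (by omega)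
        rcases hdeg x' x y z hxx'.symm hyy'.symm hxz with h | rfl | rfl
        · exact h
        · omega
        · omega
  have : Nonempty U := ⟨e⟩
  obtain ⟨m, hm⟩ := Finite.exists_max (fun x => H.dist e x)
  have hsurj : ∀ j, ∃ x, H.dist e x = H.dist e m - j := by
    intro j
    induction j with
    | zero => exact ⟨m, rfl⟩
    | succ j ih =>
      obtain ⟨x, hx⟩ := ih
      by_cases h0 : H.dist e x = 0
      · exact ⟨x, by omega⟩
      · obtain ⟨y, -, hy⟩ := hH.exists_adj_dist_add_one h0
        exact ⟨y, by omega⟩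
  let φ : U → Fin (H.dist e m + 1) := fun x => ⟨H.dist e x, Nat.lt_succ_of_le (hm x)⟩
  have hφ : Function.Bijective φ := by
    constructor
    · intro x y hxy
      exact hinj _ x y rfl (Fin.mk.inj hxy).symm
    · rintro ⟨k, hk⟩
      obtain ⟨x, hx⟩ := hsurj (H.dist e m - k)
      exact ⟨x, Fin.ext (by simp only [φ]; omega)⟩
  refine ⟨H.dist e m, ⟨⟨Equiv.ofBijective φ hφ, ?_⟩⟩⟩
  intro x y
  have key : ∀ x y, H.dist e x + 1 = H.dist e y → H.Adj x y := by
    intro x y hxy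
    obtain ⟨z, hz, hz'⟩ := hH.exists_adj_dist_add_one (u := e) (x := y) (by omega)
    obtain rfl := hinj _ z x rfl (by omega)
    exact hz.symm
  rw [pathGraph_adj]
  simp only [Equiv.ofBijective_apply, φ]
  constructor
  · rintro (h | h)
    · exact key _ _ h
    · exact (key _ _ h).symm
  · intro h
    have h1 := hH.dist_le_succ_of_adj (u := e) h
    have h2 := hH.dist_le_succ_of_adj (u := e) h.symm
    have h3 : H.dist e x ≠ H.dist e y := fun h' => h.ne (hinj _ _ _ rfl h'.symm)
    omega

/-! ### Thin systolic graphs: bridgedness and levels of intervals -/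

/-- Metric and local conditions on a graph implying that it is bridged and that all levels of its
intervals are segments. The last condition says that no edge is missing from exactly one pair of
vertices among five. -/
structure IsThinSystolic (G : SimpleGraph V) : Prop where
  connected : G.Connected
  down_clique : ∀ u w x y, G.Adj w x → G.Adj w y → G.dist u x + 1 = G.dist u w →
    G.dist u y + 1 = G.dist u w → x = y ∨ G.Adj x y
  common_down : ∀ u w x, G.Adj w x → G.dist u w = G.dist u x →
    ∃ z, G.Adj w z ∧ G.Adj x z ∧ G.dist u z + 1 = G.dist u w
  wheel_four : ∀ v a b c d, G.Adj v a → G.Adj v b → G.Adj v c → G.Adj v d →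
    G.Adj a b → G.Adj b c → G.Adj c d → G.Adj d a → a = c ∨ b = d ∨ G.Adj a c ∨ G.Adj b d
  wheel_five : ∀ v a b c d e, G.Adj v a → G.Adj v b → G.Adj v c → G.Adj v d → G.Adj v e →
    G.Adj a b → G.Adj b c → G.Adj c d → G.Adj d e → G.Adj e a →
    a = c ∨ b = d ∨ c = e ∨ d = a ∨ e = b ∨
      G.Adj a c ∨ G.Adj b d ∨ G.Adj c e ∨ G.Adj d a ∨ G.Adj e b
  diamond : ∀ a b c x y, G.Adj a b → G.Adj a c → G.Adj b c → G.Adj x a → G.Adj x b → G.Adj x c →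
    G.Adj y a → G.Adj y b → G.Adj y c → x = y ∨ G.Adj x y

namespace IsThinSystolic

variable {G : SimpleGraph V}

/-- Distances are measured from `c 0`. On an isometric cycle of even length, both cycle neighbours
of the opposite vertex are closer to `c 0`, so they are equal or adjacent, against isometry. On a
cycle of odd length at least five, the two farthest vertices have a common closer neighbour `z`, and
`down_clique` joins `z` to the next cycle vertex on either side. -/
theorem isBridged (hG : G.IsThinSystolic) : G.IsBridged := by
  refine ⟨hG.connected, fun n c hn hc => ?_⟩
  by_contra hn3
  have hd : ∀ (i j d : ℕ) (hi : i < n) (hj : j < n), i ≤ j → min (j - i) (n - (j - i)) = d →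
      G.dist (c ⟨i, hi⟩) (c ⟨j, hj⟩) = d := fun i j d hi hj hij h => by
    rw [hc, dist_cycleGraph hn _ _ hij, ← h]
  have ha : ∀ (i : ℕ) (hi : i + 1 < n), G.Adj (c ⟨i, by omega⟩) (c ⟨i + 1, hi⟩) :=
    fun i hi => dist_eq_one_iff_adj.1 (hd _ _ _ _ _ (by omega) (by omega))
  have hne : ∀ x y, 2 ≤ G.dist x y → x ≠ y ∧ ¬ G.Adj x y := by
    intro x y hxy
    constructor
    · rintro rfl; simp at hxy
    · intro h; rw [dist_eq_one_iff_adj.2 h] at hxy; omega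
  have hf : ∀ (i j : ℕ) (hi : i < n) (hj : j < n), i ≤ j → 2 ≤ min (j - i) (n - (j - i)) →
      c ⟨i, hi⟩ ≠ c ⟨j, hj⟩ ∧ ¬ G.Adj (c ⟨i, hi⟩) (c ⟨j, hj⟩) := by
    intro i j hi hj hij h
    exact hne _ _ (by rwa [hd i j _ hi hj hij rfl])
  obtain ⟨m, hm | hm⟩ := n.even_or_odd'
  · obtain ⟨m, rfl⟩ : ∃ k, m = k + 2 := ⟨m - 2, by omega⟩
    have h0 := hd 0 (m + 1) (m + 1) (by omega) (by omega) (by omega) (by omega)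
    have h1 := hd 0 (m + 1 + 1) (m + 2) (by omega) (by omega) (by omega) (by omega)
    have h2 := hd 0 (m + 1 + 1 + 1) (m + 1) (by omega) (by omega) (by omega) (by omega)
    have h3 := hf (m + 1) (m + 1 + 1 + 1) (by omega) (by omega) (by omega) (by omega)
    rcases hG.down_clique _ _ _ _ (ha (m + 1) (by omega)).symm (ha (m + 1 + 1) (by omega))
      (by rw [h0, h1]) (by rw [h2, h1]) with h | h
    · exact h3.1 h
    · exact h3.2 h
  · obtain ⟨m, rfl⟩ : ∃ k, m = k + 2 := ⟨m - 2, by omega⟩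
    have h0 := hd 0 (m + 1) (m + 1) (by omega) (by omega) (by omega) (by omega)
    have h1 := hd 0 (m + 1 + 1) (m + 2) (by omega) (by omega) (by omega) (by omega)
    have h2 := hd 0 (m + 1 + 1 + 1) (m + 2) (by omega) (by omega) (by omega) (by omega)
    have h3 := hd 0 (m + 1 + 1 + 1 + 1) (m + 1) (by omega) (by omega) (by omega) (by omega)
    have a1 := ha (m + 1) (by omega)
    have a2 := ha (m + 1 + 1) (by omega)
    have a3 := ha (m + 1 + 1 + 1) (by omega)
    have f1 := hf (m + 1) (m + 1 + 1 + 1) (by omega) (by omega) (by omega) (by omega)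
    have f2 := hf (m + 1 + 1) (m + 1 + 1 + 1 + 1) (by omega) (by omega) (by omega) (by omega)
    obtain ⟨z, z1, z2, hz⟩ := hG.common_down _ _ _ a2 (h1.trans h2.symm)
    have b1 := (hG.down_clique _ _ _ _ a1.symm z1 (by rw [h0, h1]) hz).resolve_left (by
      intro h
      rw [← h] at z2
      exact f1.2 z2.symm)
    have b2 := (hG.down_clique _ _ _ _ a3 z2 (by rw [h3, h2]) (by rw [hz, h1, h2])).resolve_left
      (by
        intro h
        rw [← h] at z1
        exact f2.2 z1)
    -- For `m = 0` the length is five, `z` is also adjacent to `c 0`, and the whole cycle lies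
    -- around `z`. For larger `m` the two vertices joined to `z` are at distance three on the cycle,
    -- although `z` gives a path of length two.
    rcases Nat.eq_zero_or_pos m with hm0 | hm0
    · have z0 : G.Adj (c ⟨0, by omega⟩) z := by
        rw [← dist_eq_one_iff_adj]
        omega
      subst hm0
      have a0 := ha 0 (by omega)
      have a4 := dist_eq_one_iff_adj.1 (hd 0 4 1 (by omega) (by omega) (by omega) (by omega))
      have f3 := hf 0 2 (by omega) (by omega) (by omega) (by omega)
      have f4 := hf 0 3 (by omega) (by omega) (by omega) (by omega)
      have f5 := hf 1 4 (by omega) (by omega) (by omega) (by omega)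
      rcases hG.wheel_five z _ _ _ _ _ z0.symm b1.symm z1.symm z2.symm b2.symm a0 a1 a2 a3 a4.symm
        with e | e | e | e | e | e | e | e | e | e
      · exact f3.1 e
      · exact f1.1 e
      · exact f2.1 e
      · exact f4.1 e.symm
      · exact f5.1 e.symm
      · exact f3.2 e
      · exact f1.2 e
      · exact f2.2 e
      · exact f4.2 e.symm
      · exact f5.2 e.symm
    · have h8 := hd (m + 1) (m + 1 + 1 + 1 + 1) 3 (by omega) (by omega) (by omega) (by omega)
      have h9 := hG.connected.dist_le_succ_of_adj (u := c ⟨m + 1, by omega⟩) b2.symm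
      rw [h8, dist_eq_one_iff_adj.2 b1] at h9
      omega

/-- Three pairwise adjacent vertices at the same distance from `u` have a common neighbour closer
to `u`. -/
theorem exists_common_down_of_triangle (hG : G.IsThinSystolic)
    {u a b c : V} (hab : G.Adj a b) (hbc : G.Adj b c)
    (hac : G.Adj a c) (h1 : G.dist u a = G.dist u b) (h2 : G.dist u b = G.dist u c) :
    ∃ z, G.Adj z a ∧ G.Adj z b ∧ G.Adj z c ∧ G.dist u z + 1 = G.dist u b := by
  obtain ⟨z, hza, hzb, hz⟩ := hG.common_down u a b hab h1
  obtain ⟨y, hyb, hyc, hy⟩ := hG.common_down u b c hbc h2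
  rcases hG.down_clique u b z y hzb hyb (by omega) hy with rfl | h
  · exact ⟨z, hza.symm, hzb.symm, hyc.symm, by omega⟩
  -- Around `b` the vertices `a`, `z`, `y`, `c` form a closed path. Equality of opposite vertices
  -- contradicts the distances from `u`, and either diagonal turns `y` or `z` into the required
  -- common neighbour.
  · rcases hG.wheel_four b a z y c hab.symm hzb hyb hbc hza h hyc.symm hac.symm with
      rfl | rfl | h' | h'
    · omega
    · omega
    · exact ⟨y, h'.symm, hyb.symm, hyc.symm, by omega⟩
    · exact ⟨z, hza.symm, hzb.symm, h', by omega⟩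

/-- A vertex has at most two neighbours closer to `u`. -/
theorem down_le_two (hG : G.IsThinSystolic)
    {u w a b c : V} (ha : G.Adj w a) (hb : G.Adj w b) (hc : G.Adj w c)
    (ha' : G.dist u a + 1 = G.dist u w) (hb' : G.dist u b + 1 = G.dist u w)
    (hc' : G.dist u c + 1 = G.dist u w) : a = b ∨ a = c ∨ b = c := by
  by_contra! h
  have hab := (hG.down_clique u w a b ha hb ha' hb').resolve_left h.1
  have hac := (hG.down_clique u w a c ha hc ha' hc').resolve_left h.2.1
  have hbc := (hG.down_clique u w b c hb hc hb' hc').resolve_left h.2.2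
  -- The triangle `a b c` has `w` on one side and `z` on the other; `diamond` makes them equal or
  -- adjacent, but their distances from `u` differ by two.
  obtain ⟨z, za, zb, zc, hz⟩ := hG.exists_common_down_of_triangle (u := u) hab hbc hac
    (by omega) (by omega)
  rcases hG.diamond a b c w z hab hac hbc ha hb hc za zb zc with rfl | h'
  · omega
  · have := hG.connected.dist_le_succ_of_adj (u := u) h'.symm
    omega

theorem mem_levelSet_iff {u v x : V} {k : ℕ} (hk : k ≤ G.dist u v) :
    x ∈ G.levelSet u v k ↔ G.dist u x = k ∧ G.dist v x = G.dist u v - k := by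
  rw [levelSet, interval, Set.mem_ofPred_eq, Set.mem_ofPred_eq, dist_comm (u := x)]
  omega

theorem levelSet_subset {u v x : V} {k : ℕ} (hx : x ∈ G.levelSet u v k) :
    G.dist u x = k ∧ G.dist v x = G.dist u v - k := by
  rw [dist_comm (u := v)]
  exact hx.2

theorem mem_levelSet_pred (hG : G.IsThinSystolic) {u v x y : V} {k : ℕ} (hk : k + 1 ≤ G.dist u v)
    (hx : x ∈ G.levelSet u v (k + 1)) (hxy : G.Adj x y) (hy : G.dist u y + 1 = G.dist u x) :
    y ∈ G.levelSet u v k := by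
  rw [mem_levelSet_iff hk] at hx
  rw [mem_levelSet_iff (by omega)]
  refine ⟨by omega, ?_⟩
  have h1 := hG.connected.dist_le_succ_of_adj (u := v) hxy
  have h2 : G.dist u v ≤ G.dist u y + G.dist y v := hG.connected.dist_triangle
  rw [dist_comm (u := y)] at h2
  omega

theorem exists_mem_levelSet_succ (hG : G.IsThinSystolic)
    {u v y : V} {k : ℕ} (hk : k + 1 ≤ G.dist u v)
    (hy : y ∈ G.levelSet u v k) :
    ∃ x ∈ G.levelSet u v (k + 1), G.Adj x y ∧ G.dist u y + 1 = G.dist u x := by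
  rw [mem_levelSet_iff (by omega)] at hy
  obtain ⟨x, hyx, hx⟩ := hG.connected.exists_adj_dist_add_one (u := v) (x := y) (by omega)
  have h1 := hG.connected.dist_le_succ_of_adj (u := u) hyx
  have h2 : G.dist u v ≤ G.dist u x + G.dist x v := hG.connected.dist_triangle
  rw [dist_comm (u := x)] at h2
  refine ⟨x, ?_, hyx.symm, by omega⟩
  rw [mem_levelSet_iff hk]
  omega

/-- Inside an interval the neighbours in direction `u` are at distance two from those in
direction `v`. -/
theorem not_adj_of_levels (hG : G.IsThinSystolic) {u v x y z : V} {k : ℕ} (hk : k < G.dist u v)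
    (hx : x ∈ G.levelSet u v k) (hy : G.dist u y + 1 = G.dist u x)
    (hz : G.dist v z + 1 = G.dist v x) : y ≠ z ∧ ¬ G.Adj y z := by
  have hx' := levelSet_subset hx
  have h2 : G.dist u v ≤ G.dist u z + G.dist z v := hG.connected.dist_triangle
  rw [dist_comm (u := z)] at h2
  refine ⟨?_, fun h => ?_⟩
  · rintro rfl; omega
  · have := hG.connected.dist_le_succ_of_adj (u := u) h
    omega

/-- A triangle in a level has a common neighbour towards `u` and one towards `v`. By `diamond` these
are equal or adjacent, while a shortest path through the level keeps them at distance two. -/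
theorem levelSet_triangle_free (hG : G.IsThinSystolic)
    {u v a b c : V} {k : ℕ} (hk : k < G.dist u v)
    (ha : a ∈ G.levelSet u v k) (hb : b ∈ G.levelSet u v k) (hc : c ∈ G.levelSet u v k)
    (hab : G.Adj a b) (hbc : G.Adj b c) (hac : G.Adj a c) : False := by
  have ha' := levelSet_subset ha
  have hb' := levelSet_subset hb
  have hc' := levelSet_subset hc
  obtain ⟨z, za, zb, zc, hz⟩ := hG.exists_common_down_of_triangle (u := u) hab hbc hac
    (by omega) (by omega)
  obtain ⟨y, ya, yb, yc, hy⟩ := hG.exists_common_down_of_triangle (u := v) hab hbc hac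
    (by omega) (by omega)
  have := hG.not_adj_of_levels hk hb hz hy
  rcases hG.diamond a b c z y hab hac hbc za zb zc ya yb yc with h | h
  · exact this.1 h
  · exact this.2 h

/-- Two edges of a level at the same vertex do not have a common neighbour closer to `u`. -/
theorem no_common_down_of_two_edges (hG : G.IsThinSystolic) {u v x a b z : V} {k : ℕ}
    (hk : k < G.dist u v)
    (hx : x ∈ G.levelSet u v k) (ha : a ∈ G.levelSet u v k) (hb : b ∈ G.levelSet u v k)
    (hxa : G.Adj x a) (hxb : G.Adj x b) (hab : a ≠ b) (hzx : G.Adj x z) (hza : G.Adj a z)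
    (hzb : G.Adj b z) (hz : G.dist u z + 1 = G.dist u x) : False := by
  have hx' := levelSet_subset hx
  have ha' := levelSet_subset ha
  have hb' := levelSet_subset hb
  have hnab : ¬ G.Adj a b := fun h => hG.levelSet_triangle_free hk hx ha hb hxa h hxb
  -- If the two edges also had a common neighbour `y` towards `v`, the closed path `a`, `z`, `b`,
  -- `y` around `x` would have neither diagonal.
  have key : ∀ y, G.Adj x y → G.Adj a y → G.Adj b y → G.dist v y + 1 = G.dist v x → False := by
    intro y hxy hay hby hy
    have := hG.not_adj_of_levels hk hx hz hy
    have := hG.wheel_four x a z b y hxa hzx hxb hxy hza hzb.symm hby hay.symm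
    tauto
  obtain ⟨y, hyx, hya, hy⟩ := hG.common_down v x a hxa (by omega)
  obtain ⟨w, hwx, hwb, hw⟩ := hG.common_down v x b hxb (by omega)
  rcases hG.down_clique v x y w hyx hwx hy hw with rfl | hyw
  · exact key y hyx hya hwb hy
  · have h1 := hG.not_adj_of_levels hk hx hz hy
    have h2 := hG.not_adj_of_levels hk hx hz hw
    have h3 : b ≠ y := by rintro rfl; omega
    have h4 : w ≠ a := by rintro rfl; omega
    -- The closed path `a`, `z`, `b`, `w`, `y` around `x`: its only possible diagonals are `b y` and
    -- `w a`, and each of them makes `y` or `w` a common neighbour as excluded by `key`.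
    have := hG.wheel_five x a z b w y hxa hzx hxb hwx hyx hza hzb.symm hwb hyw.symm hya.symm
    rw [eq_comm (a := y), G.adj_comm y z, G.adj_comm w a] at this
    rcases this with h | h | h | h | h | h | h | h | h | h
    · exact hab h
    · exact h2.1 h
    · exact h3 h
    · exact h4 h
    · exact h1.1 h
    · exact hnab h
    · exact h2.2 h
    · exact key y hyx hya h hy
    · exact key w hwx h hwb hw
    · exact h1.2 h

/-- Each edge of the level at `x` has a common neighbour towards `u`. There are only two candidates
among the neighbours of `x`, so three edges would force two of them to share one. -/
theorem levelSet_degree_le_two (hG : G.IsThinSystolic) {u v x a b c : V} {k : ℕ}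
    (hk : k < G.dist u v)
    (hx : x ∈ G.levelSet u v k) (ha : a ∈ G.levelSet u v k) (hb : b ∈ G.levelSet u v k)
    (hc : c ∈ G.levelSet u v k) (hxa : G.Adj x a) (hxb : G.Adj x b) (hxc : G.Adj x c) :
    a = b ∨ a = c ∨ b = c := by
  have hx' := levelSet_subset hx
  have ha' := levelSet_subset ha
  have hb' := levelSet_subset hb
  have hc' := levelSet_subset hc
  by_contra! hne
  obtain ⟨za, h1, h2, h3⟩ := hG.common_down u x a hxa (by omega)
  obtain ⟨zb, h4, h5, h6⟩ := hG.common_down u x b hxb (by omega)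
  obtain ⟨zc, h7, h8, h9⟩ := hG.common_down u x c hxc (by omega)
  rcases hG.down_le_two h1 h4 h7 h3 h6 h9 with rfl | rfl | rfl
  · exact hG.no_common_down_of_two_edges hk hx ha hb hxa hxb hne.1 h1 h2 h5 h3
  · exact hG.no_common_down_of_two_edges hk hx ha hc hxa hxc hne.2.1 h1 h2 h8 h3
  · exact hG.no_common_down_of_two_edges hk hx hb hc hxb hxc hne.2.2 h4 h5 h8 h6

theorem levelSet_zero (hG : G.IsThinSystolic) {u v : V} : G.levelSet u v 0 = {u} := by
  ext x
  rw [mem_levelSet_iff (Nat.zero_le _), Set.mem_singleton_iff, hG.connected.dist_eq_zero_iff]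
  constructor
  · exact fun h => h.1.symm
  · rintro rfl
    exact ⟨rfl, by rw [dist_comm]; rfl⟩

theorem levelSet_dist (hG : G.IsThinSystolic) {u v : V} : G.levelSet u v (G.dist u v) = {v} := by
  ext x
  rw [mem_levelSet_iff le_rfl, Set.mem_singleton_iff, Nat.sub_self,
    hG.connected.dist_eq_zero_iff]
  constructor
  · exact fun h => h.2.symm
  · rintro rfl
    exact ⟨rfl, rfl⟩

/-- A property of levels that passes towards `u` and holds for the last level holds for all. -/
theorem levelSet_induction {u v : V} {P : ℕ → Prop} (h0 : P (G.dist u v))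
    (h : ∀ k, k + 1 ≤ G.dist u v → P (k + 1) → P k) {k : ℕ} (hk : k ≤ G.dist u v) : P k := by
  obtain ⟨j, hj⟩ := Nat.exists_eq_add_of_le hk
  induction j generalizing k with
  | zero => rwa [← hj.trans (Nat.add_zero k)]
  | succ j ih => exact h k (by omega) (ih (by omega) (by omega))

/-- Every vertex of level `k` is a neighbour, closer to `u`, of a vertex of level `k + 1`, and each
of the latter has at most two such neighbours. The induction descends from the last level `{v}`. -/
theorem levelSet_finite (hG : G.IsThinSystolic)
    {u v : V} {k : ℕ} (hk : k ≤ G.dist u v) : (G.levelSet u v k).Finite := by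
  refine levelSet_induction (P := fun k => (G.levelSet u v k).Finite) ?_ ?_ hk
  · rw [hG.levelSet_dist]
    exact Set.finite_singleton v
  · intro k hk ih
    have hsub : G.levelSet u v k ⊆
        ⋃ x ∈ G.levelSet u v (k + 1), {y | G.Adj x y ∧ G.dist u y + 1 = G.dist u x} := by
      intro y hy
      obtain ⟨x, hx, hxy, hd⟩ := hG.exists_mem_levelSet_succ hk hy
      exact Set.mem_biUnion hx ⟨hxy, hd⟩
    refine (ih.biUnion fun x _ => ?_).subset hsub
    by_contra hinf
    obtain ⟨t, ht, hcard⟩ := Set.Infinite.exists_subset_card_eq hinf 3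
    classical
    obtain ⟨a, b, c, hab, hac, hbc, rfl⟩ := Finset.card_eq_three.1 hcard
    have ha := ht (show a ∈ _ by simp)
    have hb := ht (show b ∈ _ by simp)
    have hc := ht (show c ∈ _ by simp)
    rcases hG.down_le_two ha.1 hb.1 hc.1 ha.2 hb.2 hc.2 with h | h | h
    · exact hab h
    · exact hac h
    · exact hbc h

/-- A path in level `k + 1` projects to level `k`: its edges have common neighbours closer to `u`,
and two closer neighbours of the same vertex are equal or adjacent. -/
theorem levelSet_connected (hG : G.IsThinSystolic) {u v : V} {k : ℕ} (hk : k ≤ G.dist u v) :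
    (G.induce (G.levelSet u v k)).Connected := by
  refine levelSet_induction (P := fun k => (G.induce (G.levelSet u v k)).Connected) ?_ ?_ hk
  · rw [hG.levelSet_dist]
    have : Nonempty ({v} : Set V) := ⟨⟨v, rfl⟩⟩
    refine ⟨fun a b => ?_⟩
    rw [Subsingleton.elim a b]
  · intro k hk ih
    have hadj : ∀ (x : V) (a b : G.levelSet u v k), x ∈ G.levelSet u v (k + 1) → G.Adj x a →
        G.Adj x b → (G.induce (G.levelSet u v k)).Reachable a b := by
      intro x a b hx hxa hxb
      have ha := levelSet_subset a.2
      have hb := levelSet_subset b.2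
      have hx' := levelSet_subset hx
      rcases hG.down_clique u x a b hxa hxb (by omega) (by omega) with h | h
      · rw [Subtype.ext h]
      · exact Adj.reachable (G := G.induce (G.levelSet u v k)) h
    have key : ∀ (x y : G.levelSet u v (k + 1)), (G.induce (G.levelSet u v (k + 1))).Walk x y →
        ∀ a b : G.levelSet u v k, G.Adj x a → G.Adj y b →
          (G.induce (G.levelSet u v k)).Reachable a b := by
      intro x y p
      induction p with
      | nil => exact fun a b ha hb => hadj _ a b (Subtype.coe_prop _) ha hb
      | @cons x x' y hxx' p ih =>
        intro a b ha hb
        have h1 := levelSet_subset x.2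
        have h2 := levelSet_subset x'.2
        obtain ⟨z, hz, hz', hd⟩ := hG.common_down u x x' hxx' (by omega)
        have hz3 := hG.mem_levelSet_pred hk x.2 hz hd
        exact (hadj x a ⟨z, hz3⟩ x.2 ha hz).trans (ih ⟨z, hz3⟩ b hz' hb)
    obtain ⟨⟨x, hx⟩⟩ := ih.nonempty
    have hx' := levelSet_subset hx
    obtain ⟨z, hz, hd⟩ := hG.connected.exists_adj_dist_add_one (u := u) (x := x) (by omega)
    have : Nonempty (G.levelSet u v k) := ⟨⟨z, hG.mem_levelSet_pred hk hx hz hd⟩⟩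
    refine ⟨fun a b => ?_⟩
    obtain ⟨x, hx, hxa, -⟩ := hG.exists_mem_levelSet_succ hk a.2
    obtain ⟨y, hy, hyb, -⟩ := hG.exists_mem_levelSet_succ hk b.2
    obtain ⟨p⟩ := ih.preconnected ⟨x, hx⟩ ⟨y, hy⟩
    exact key _ _ p a b hxa hyb

/-- Some vertex of a level is not an interior vertex. -/
theorem levelSet_exists_end (hG : G.IsThinSystolic) {u v : V} {k : ℕ} (hk : k < G.dist u v) :
    ∃ x ∈ G.levelSet u v k, ∀ a ∈ G.levelSet u v k, ∀ b ∈ G.levelSet u v k,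
      G.Adj x a → G.Adj x b → a = b := by
  induction k with
  | zero =>
    rw [hG.levelSet_zero]
    refine ⟨u, rfl, ?_⟩
    rintro a rfl b rfl - -
    rfl
  | succ k ih =>
    obtain ⟨y, hy, hend⟩ := ih (by omega)
    by_contra! hno
    obtain ⟨x, hx, hxy, hd⟩ := hG.exists_mem_levelSet_succ (k := k) (by omega) hy
    have hx' := levelSet_subset hx
    -- Here `y` is an end of level `k`, and it lies below the edge `x x1`. If neither `x` nor `x1`
    -- were an end, the other edges at `x` and at `x1` would lie above neighbours `z2` and `z3` of
    -- `y` in level `k`, both different from `y`. As `y` is an end, `z2 = z3`, and this vertex lies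
    -- below two edges at `x`.
    have key : ∀ x1 ∈ G.levelSet u v (k + 1), ∀ x2 ∈ G.levelSet u v (k + 1), x1 ≠ x2 →
        G.Adj x x1 → G.Adj x x2 → G.Adj x1 y → False := by
      intro x1 h1 x2 h2 hne hx1 hx2 h1y
      have h1' := levelSet_subset h1
      have h2' := levelSet_subset h2
      obtain ⟨z2, hxz2, hx2z2, hz2⟩ := hG.common_down u x x2 hx2 (by omega)
      have hyz2 : y ≠ z2 := by
        rintro rfl
        exact hG.no_common_down_of_two_edges hk hx h1 h2 hx1 hx2 hne hxy h1y hx2z2 hd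
      have ayz2 := (hG.down_clique u x y z2 hxy hxz2 hd hz2).resolve_left hyz2
      obtain ⟨x3, h3, h13, h3x⟩ : ∃ x3 ∈ G.levelSet u v (k + 1), G.Adj x1 x3 ∧ x3 ≠ x := by
        obtain ⟨a, ha, b, hb, hxa, hxb, hab⟩ := hno x1 h1
        by_cases hax : a = x
        · exact ⟨b, hb, hxb, fun h => hab (hax.trans h.symm)⟩
        · exact ⟨a, ha, hxa, hax⟩
      have h3' := levelSet_subset h3
      obtain ⟨z3, h1z3, h3z3, hz3⟩ := hG.common_down u x1 x3 h13 (by omega)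
      have hyz3 : y ≠ z3 := by
        rintro rfl
        exact hG.no_common_down_of_two_edges hk h1 hx h3 hx1.symm h13 h3x.symm h1y hxy
          h3z3 hz3
      have ayz3 := (hG.down_clique u x1 y z3 h1y h1z3 (by omega) hz3).resolve_left hyz3
      have h23 := hend z2 (hG.mem_levelSet_pred (by omega) hx hxz2 hz2) z3
        (hG.mem_levelSet_pred (by omega) h1 h1z3 hz3) ayz2 ayz3
      subst h23
      exact hG.no_common_down_of_two_edges hk hx h1 h2 hx1 hx2 hne hxz2 h1z3 hx2z2 hz2
    obtain ⟨x1, h1, x2, h2, hx1, hx2, hne⟩ := hno x hx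
    have h1' := levelSet_subset h1
    have h2' := levelSet_subset h2
    obtain ⟨z1, hxz1, hx1z1, hz1⟩ := hG.common_down u x x1 hx1 (by omega)
    obtain ⟨z2, hxz2, hx2z2, hz2⟩ := hG.common_down u x x2 hx2 (by omega)
    -- Below `x` there is room for only two of `y`, `z1`, `z2`: either `y` lies below one of the two
    -- edges at `x`, or both edges have the same vertex below them.
    rcases hG.down_le_two hxy hxz1 hxz2 hd hz1 hz2 with rfl | rfl | rfl
    · exact key x1 h1 x2 h2 hne hx1 hx2 hx1z1
    · exact key x2 h2 x1 h1 hne.symm hx2 hx1 hx2z2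
    · exact hG.no_common_down_of_two_edges hk hx h1 h2 hx1 hx2 hne hxz1 hx1z1 hx2z2 hz1

theorem levelSet_isSegment (hG : G.IsThinSystolic) (u v : V) {k : ℕ} (hk : k ≤ G.dist u v) :
    (G.induce (G.levelSet u v k)).IsSegment := by
  have := (hG.levelSet_finite hk).to_subtype
  have hsub : (G.levelSet u v k).Subsingleton → (G.induce (G.levelSet u v k)).IsSegment := by
    intro hs
    obtain ⟨x⟩ := (hG.levelSet_connected hk).nonempty
    exact isSegment_of_degree_le_two (hG.levelSet_connected hk)
      (fun _ a b _ _ _ _ => Or.inl (Subtype.ext (hs a.2 b.2))) x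
      (fun a b _ _ => Subtype.ext (hs a.2 b.2))
  -- The last level is `{v}`; the bounds on degrees and the existence of an end require `k` to be
  -- smaller than the distance.
  rcases hk.eq_or_lt with rfl | hlt
  · exact hsub (by rw [hG.levelSet_dist]; exact Set.subsingleton_singleton)
  obtain ⟨e, he, hend⟩ := hG.levelSet_exists_end hlt
  refine isSegment_of_degree_le_two (hG.levelSet_connected hk) ?_ ⟨e, he⟩ ?_
  · intro x a b c ha hb hc
    simpa only [Subtype.ext_iff] using
      hG.levelSet_degree_le_two hlt x.2 a.2 b.2 c.2 ha hb hc
  · intro a b ha hb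
    exact Subtype.ext (hend a a.2 b b.2 ha hb)

end IsThinSystolic

end SimpleGraph

/-! ### Flag completions and fitness -/

namespace AbstractSimplicialComplex

open SimpleGraph

theorem isFlag_flagCompletion {V : Type*} (G : SimpleGraph V) :
    G.flagCompletion.oneSkeleton = G ∧ G.flagCompletion.IsFlag := by
  have h : G.flagCompletion.oneSkeleton = G := by
    ext x y
    constructor
    · rintro ⟨hne, s, ⟨-, hs⟩, hx, hy⟩
      exact hs hx hy hne
    · intro hxy
      classical
      refine ⟨hxy.ne, {x, y}, ⟨by simp, ?_⟩, by simp, by simp⟩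
      simpa [isClique_iff, Set.pairwise_pair, hxy.symm] using fun _ => hxy
  refine ⟨h, fun s hs hc => ⟨hs, ?_⟩⟩
  rwa [h] at hc

/-- An isomorphism from a level to a finite path preserves the graph metrics, so `B = 1` works with
any positive `C`. -/
theorem isFit_flagCompletion {V : Type*} {G : SimpleGraph V} (hG : G.IsThinSystolic) :
    G.flagCompletion.IsFit := by
  obtain ⟨h1, h2⟩ := isFlag_flagCompletion G
  refine ⟨⟨h2, by rw [h1]; exact hG.isBridged⟩, 1, 1, one_pos, one_pos, ?_⟩
  rw [h1]
  intro u v k hk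
  obtain ⟨n, ⟨e⟩⟩ := hG.levelSet_isSegment u v hk
  have hd : ∀ x y, (pathGraph (n + 1)).dist (e x) (e y) =
      (G.induce (G.levelSet u v k)).dist x y := by
    intro x y
    apply le_antisymm
    · obtain ⟨p, hp⟩ := (hG.levelSet_connected hk).exists_walk_length_eq_dist x y
      rw [← hp]
      simpa using dist_le (p.map e.toHom)
    · obtain ⟨p, hp⟩ := (pathGraph_connected n).exists_walk_length_eq_dist (e x) (e y)
      rw [← hp]
      simpa using dist_le ((p.map e.symm.toHom).copy (e.symm_apply_apply x) (e.symm_apply_apply y))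
  refine ⟨n, e, fun y => ⟨e.symm y, by simp⟩, fun x y => ?_⟩
  rw [hd]
  constructor <;> simp

end AbstractSimplicialComplex

-- Locally 6-large triangle complexes and the spheres of their universal covers

universe u v

/-- A locally `6`-large triangle complex, possibly with loops and multiple edges. `Tri a b c` means
that the arrows `a : x → y`, `b : x → z` and `c : y → z` bound a triangle, so that `a` and `b` are
adjacent in the link of `x`. -/
structure TriangleComplex (V : Type u) (A : Type v) where
  /-- initial vertex -/
  src : A → V
  /-- terminal vertex -/
  tgt : A → V
  /-- reversed arrow -/
  rev : A → A
  /-- triangles -/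
  Tri : A → A → A → Prop
  rev_rev : ∀ a, rev (rev a) = a
  src_rev : ∀ a, src (rev a) = tgt a
  tri_src : ∀ {a b c}, Tri a b c → src a = src b ∧ src c = tgt a ∧ tgt c = tgt b
  swap : ∀ {a b c}, Tri a b c → Tri b a (rev c)
  rotate : ∀ {a b c}, Tri a b c → Tri (rev a) c b
  unique : ∀ {a b c c'}, Tri a b c → Tri a b c' → c = c'
  irrefl : ∀ a c, ¬ Tri a a c
  tetra : ∀ {a b c d e g}, Tri a b c → Tri a d e → Tri b d g → Tri c e g
  square : ∀ {a b c d ab bc cd da}, Tri a b ab → Tri b c bc → Tri c d cd → Tri d a da →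
    a = c ∨ b = d ∨ (∃ x, Tri a c x) ∨ ∃ x, Tri b d x
  pentagon : ∀ {a b c d e ab bc cd de ea}, Tri a b ab → Tri b c bc → Tri c d cd → Tri d e de →
    Tri e a ea → a = c ∨ b = d ∨ c = e ∨ d = a ∨ e = b ∨
      (∃ x, Tri a c x) ∨ (∃ x, Tri b d x) ∨ (∃ x, Tri c e x) ∨ (∃ x, Tri d a x) ∨ ∃ x, Tri e b x
  diamond : ∀ {a b c d ab ac bc ad bd}, Tri a b ab → Tri a c ac → Tri b c bc → Tri a d ad →
    Tri b d bd → c = d ∨ ∃ x, Tri c d x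

namespace TriangleComplex

variable {V : Type u} {A : Type v} (K : TriangleComplex V A)

theorem tgt_rev (a : A) : K.tgt (K.rev a) = K.src a := by
  rw [← K.src_rev, K.rev_rev]

/-- A sphere in the universal cover: a set `S` of vertices mapped to `V`, for every vertex the set
`Down` of arrows leading towards the centre, and the relation `Hor` of being joined by an arrow
inside the sphere. -/
structure Layer where
  S : Type v
  pr : S → V
  Down : S → A → Prop
  Hor : S → A → S → Prop
  down_src : ∀ {s d}, Down s d → K.src d = pr s
  down_clique : ∀ {s d d'}, Down s d → Down s d' → d = d' ∨ ∃ x, K.Tri d d' x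
  hor_src : ∀ {s a t}, Hor s a t → K.src a = pr s ∧ K.tgt a = pr t
  hor_unique : ∀ {s a t t'}, Hor s a t → Hor s a t' → t = t'
  hor_symm : ∀ {s a t}, Hor s a t → Hor t (K.rev a) s
  hor_not_down : ∀ {s a t}, Hor s a t → ¬ Down s a
  hor_down : ∀ {s a t}, Hor s a t → ∃ d x, Down s d ∧ K.Tri d a x
  down_transfer : ∀ {s a t d c}, Hor s a t → K.Tri a d c → Down s d → Down t c
  hor_tri : ∀ {s a t b r c}, Hor s a t → Hor s b r → K.Tri a b c → Hor t c r
  saturated : ∀ {s d a x}, Down s d → K.Tri d a x → Down s a ∨ ∃ t, Hor s a t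

namespace Layer

variable {K} (L : K.Layer)

/-- The arrows leading away from the centre. -/
def Up (s : L.S) (a : A) : Prop :=
  K.src a = L.pr s ∧ ¬ L.Down s a ∧ ∀ t, ¬ L.Hor s a t

variable {L}

/-- If `c` went down or stayed in the sphere at `t`, then moving the triangle back along the reverse
of `e` would show the same for `a` at `s`. -/
theorem Up.transfer {s t : L.S} {a e c : A} (ha : L.Up s a) (he : L.Hor s e t)
    (h : K.Tri e a c) : L.Up t c := by
  have h' := K.rotate h
  refine ⟨(K.tri_src h).2.1.trans (L.hor_src he).2, fun hc => ?_, fun r hr => ?_⟩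
  · exact ha.2.1 (L.down_transfer (L.hor_symm he) h' hc)
  · exact ha.2.2 r (L.hor_tri (L.hor_symm he) hr h')

theorem Up.not_tri_down {s : L.S} {a d x : A} (ha : L.Up s a) (hd : L.Down s d) :
    ¬ K.Tri d a x := by
  intro h
  rcases L.saturated hd h with h' | ⟨t, h'⟩
  · exact ha.2.1 h'
  · exact ha.2.2 t h'

/-- Two arrows leading away from the centre have the same end. -/
def Same (L : K.Layer) (p q : L.S × A) : Prop :=
  p = q ∨ ∃ e, L.Hor p.1 e q.1 ∧ K.Tri e p.2 q.2

theorem Same.symm {p q : L.S × A} (h : L.Same p q) : L.Same q p := by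
  rcases h with rfl | ⟨e, he, ht⟩
  · exact Or.inl rfl
  · exact Or.inr ⟨K.rev e, L.hor_symm he, K.rotate ht⟩

/-- Local `6`-largeness enters here. The horizontal arrows `b` and `c` are adjacent in the link to
the up arrow `a` and to down arrows `d` and `e`, which are equal or adjacent. This closes a path of
length four or five in the link. An up arrow is never adjacent to a down arrow, so the surviving
diagonals lead to `b c`. -/
theorem tri_of_hor_of_up {s t r : L.S} {a b c x y : A} (ha : L.Up s a) (hb : L.Hor s b t)
    (hc : L.Hor s c r) (hba : K.Tri b a x) (hca : K.Tri c a y) : b = c ∨ ∃ z, K.Tri b c z := by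
  obtain ⟨d, u, hd, hdb⟩ := L.hor_down hb
  obtain ⟨e, w, he, hec⟩ := L.hor_down hc
  have key : ∀ f m n, L.Down s f → K.Tri f b m → K.Tri f c n → b = c ∨ ∃ z, K.Tri b c z := by
    intro f m n hf h1 h2
    rcases K.square (K.swap hba) (K.swap h1) h2 hca with h | h | ⟨z, h⟩ | h
    · exact absurd hf (h ▸ ha.2.1)
    · exact Or.inl h
    · exact absurd (K.swap h) (ha.not_tri_down hf)
    · exact Or.inr h
  rcases L.down_clique hd he with rfl | ⟨z, hde⟩
  · exact key _ _ _ hd hdb hec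
  · rcases K.pentagon (K.swap hba) (K.swap hdb) hde hec hca with
      h | h | h | h | h | ⟨z, h⟩ | ⟨z, h⟩ | ⟨z, h⟩ | ⟨z, h⟩ | ⟨z, h⟩
    · exact absurd hd (h ▸ ha.2.1)
    · exact absurd he (h ▸ L.hor_not_down hb)
    · exact absurd hd (h ▸ L.hor_not_down hc)
    · exact absurd he (h ▸ ha.2.1)
    · exact Or.inl h.symm
    · exact absurd (K.swap h) (ha.not_tri_down hd)
    · exact key _ _ _ he (K.swap h) hec
    · exact key _ _ _ hd hdb h
    · exact absurd h (ha.not_tri_down he)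
    · exact Or.inr ⟨_, K.swap h⟩

/-- At the middle vertex the two horizontal arrows are both adjacent to the up arrow `q.2`, hence
equal or adjacent to each other. In the second case `hor_tri` and `tetra` provide the horizontal
arrow and the triangle from `p` to `r`. -/
theorem Same.trans {p q r : L.S × A} (hq : L.Up q.1 q.2) (h : L.Same p q) (h' : L.Same q r) :
    L.Same p r := by
  rcases h with rfl | ⟨e, he, ht⟩
  · exact h'
  rcases h' with rfl | ⟨g, hg, hs⟩
  · exact Or.inr ⟨e, he, ht⟩
  have he' := L.hor_symm he
  have ht' := K.rotate ht
  rcases tri_of_hor_of_up hq he' hg ht' hs with rfl | ⟨z, hz⟩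
  · left
    exact Prod.ext (L.hor_unique he' hg) (K.unique ht' hs)
  · exact Or.inr ⟨z, L.hor_tri he' hg hz, K.tetra hz ht' hs⟩

theorem Same.tgt {p q : L.S × A} (h : L.Same p q) : K.tgt p.2 = K.tgt q.2 := by
  rcases h with rfl | ⟨e, he, ht⟩
  · rfl
  · exact (K.tri_src ht).2.2.symm

/-- The triangle over `rev p.2` and `a` starting at the end of `p` can be moved to any other
arrow `q` with the same end. -/
theorem Same.transfer {p q : L.S × A} {a b b' : A} (hpq : L.Same p q)
    (hb : L.Up p.1 b) (h : K.Tri p.2 b a) (h' : K.Tri q.2 b' a) :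
    L.Up q.1 b' ∧ L.Same (p.1, b) (q.1, b') := by
  rcases hpq with rfl | ⟨g, hg, ht⟩
  · have : b = b' := K.unique (K.rotate h) (K.rotate h')
    subst this
    exact ⟨hb, Or.inl rfl⟩
  · have h1 : K.Tri (K.rev p.2) (K.rev q.2) g := K.rotate (K.swap ht)
    have h2 : K.Tri b g (K.rev b') :=
      K.tetra (K.rotate h) h1 (K.swap (K.rotate h'))
    have h3 : K.Tri g b b' := by
      have := K.swap h2
      rwa [K.rev_rev] at this
    exact ⟨hb.transfer hg h3, Or.inr ⟨g, hg, h3⟩⟩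

/-- The arrows leading away from the centre, as a set. -/
def UpArrow (L : K.Layer) : Type v := {p : L.S × A // L.Up p.1 p.2}

/-- Two arrows leading away from the centre are identified if they have the same end. -/
instance upSetoid (L : K.Layer) : Setoid L.UpArrow where
  r p q := L.Same p.1 q.1
  iseqv := ⟨fun _ => Or.inl rfl, Same.symm, fun {_ q _} h h' => Same.trans q.2 h h'⟩

/-- The end of an arrow leading away from the centre. -/
def tip {s : L.S} {a : A} (h : L.Up s a) : Quotient L.upSetoid := Quotient.mk _ ⟨(s, a), h⟩

theorem tip_eq_iff {s t : L.S} {a b : A} {ha : L.Up s a} {hb : L.Up t b} :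
    tip ha = tip hb ↔ L.Same (s, a) (t, b) := Quotient.eq

theorem exists_tip (w : Quotient L.upSetoid) : ∃ s a, ∃ h : L.Up s a, w = tip h := by
  induction w using Quotient.ind with
  | _ p => exact ⟨p.1.1, p.1.2, p.2, rfl⟩

/-- Arrows from the next sphere back to the sphere. -/
def NextDown (L : K.Layer) (w : Quotient L.upSetoid) (d : A) : Prop :=
  ∃ s a, ∃ h : L.Up s a, w = tip h ∧ d = K.rev a

/-- Arrows inside the next sphere. -/
def NextHor (L : K.Layer) (w : Quotient L.upSetoid) (e : A) (w' : Quotient L.upSetoid) : Prop :=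
  ∃ s a b, ∃ (ha : L.Up s a) (hb : L.Up s b), w = tip ha ∧ w' = tip hb ∧ K.Tri a b e

theorem NextHor.symm {w w' : Quotient L.upSetoid} {e : A} (h : L.NextHor w e w') :
    L.NextHor w' (K.rev e) w := by
  obtain ⟨s, a, b, ha, hb, rfl, rfl, h⟩ := h
  exact ⟨s, b, a, hb, ha, rfl, rfl, K.swap h⟩

/-- `NextHor` asks for a triangle over one representative of each end. This lemma permits any
representative of the initial vertex under which the arrow spans a triangle. -/
theorem NextHor.move {s : L.S} {a e c : A} {ha : L.Up s a} {w' : Quotient L.upSetoid}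
    (h : L.NextHor (tip ha) e w') (ht : K.Tri a c e) : ∃ hc : L.Up s c, w' = tip hc := by
  obtain ⟨t, a', b, ha', hb, hw, rfl, h⟩ := h
  obtain ⟨h1, h2⟩ := Same.transfer (tip_eq_iff.1 hw).symm hb h ht
  exact ⟨h1, tip_eq_iff.2 h2⟩

/-- Otherwise the side `b` of the triangle below the arrow would be the horizontal arrow between two
representatives of `w`, although `b` leads up. -/
theorem NextHor.not_nextDown {w w' : Quotient L.upSetoid} {e : A} (h : L.NextHor w e w') :
    ¬ L.NextDown w e := by
  obtain ⟨s, a, b, ha, hb, rfl, rfl, h⟩ := h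
  rintro ⟨t, a', ha', hw, rfl⟩
  rcases tip_eq_iff.1 hw with h' | ⟨g, hg, ht⟩
  · obtain ⟨-, rfl⟩ := Prod.mk.inj h'
    exact K.irrefl _ _ (K.rotate h)
  · have : b = g := K.unique (K.rotate h) (K.rotate (K.swap ht))
    subst this
    exact hb.2.2 _ hg

theorem NextHor.unique {w w' w'' : Quotient L.upSetoid} {e : A} (h : L.NextHor w e w')
    (h' : L.NextHor w e w'') : w' = w'' := by
  obtain ⟨s, a, b, ha, hb, rfl, rfl, h⟩ := h
  obtain ⟨_, rfl⟩ := h'.move h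
  rfl

/-- The triangles under the two horizontal arrows may start at different representatives `p` and
`p'` of `w`. In the link of `w` the arrows `rev p`, `a`, `b`, `rev p'` form a closed path of length
four. A horizontal arrow is not a down arrow, so `square` gives a diagonal, which puts both
triangles over one representative; then `tetra` applies. -/
theorem NextHor.tri {w w' w'' : Quotient L.upSetoid} {a b c : A} (h : L.NextHor w a w')
    (h' : L.NextHor w b w'') (ht : K.Tri a b c) : L.NextHor w' c w'' := by
  have key : ∀ {s : L.S} {p q x : A} {hp : L.Up s p} {hq : L.Up s q} {w'' : Quotient L.upSetoid}
      {a b c : A}, K.Tri p q a → L.NextHor (tip hp) b w'' → K.Tri (K.rev p) b x → K.Tri a b c →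
      L.NextHor (tip hq) c w'' := by
    intro s p q x hp hq w'' a b c h h' hx ht
    have hx' := K.rotate hx
    rw [K.rev_rev] at hx'
    obtain ⟨hu, rfl⟩ := h'.move hx'
    exact ⟨s, q, x, hq, hu, rfl, rfl, K.tetra (K.rotate h) hx ht⟩
  have h0 := h.not_nextDown
  have h0' := h'.not_nextDown
  have hh := h
  have hh' := h'
  obtain ⟨s, p, q, hp, hq, rfl, rfl, h⟩ := h
  obtain ⟨t, p', q', hp', hq', hw, rfl, h'⟩ := h'
  rcases tip_eq_iff.1 hw with he | ⟨g, hg, hpp⟩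
  · obtain ⟨rfl, rfl⟩ := Prod.mk.inj he
    exact key h hh' (K.rotate h') ht
  · have h1 : K.Tri (K.rev p) (K.rev p') g := K.rotate (K.swap hpp)
    rcases K.square (K.rotate h) ht (K.swap (K.rotate h')) (K.swap h1) with
      e | e | ⟨x, e⟩ | ⟨x, e⟩
    · exact absurd ⟨s, p, hp, rfl, e.symm⟩ h0'
    · exact absurd ⟨t, p', hp', hw, e⟩ h0
    · exact key h hh' e ht
    · rw [hw] at hh
      have := key (hq := hq') h' hh (K.swap e) (K.swap ht)
      have := this.symm
      rwa [K.rev_rev] at this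

/-- The next sphere. -/
def next (L : K.Layer) : K.Layer where
  S := Quotient L.upSetoid
  pr := Quotient.lift (fun p => K.tgt p.1.2) fun _ _ h => Same.tgt h
  Down := L.NextDown
  Hor := L.NextHor
  down_src := by
    rintro _ _ ⟨s, a, h, rfl, rfl⟩
    exact K.src_rev a
  down_clique := by
    rintro _ _ _ ⟨s, a, h, rfl, rfl⟩ ⟨t, b, h', hw, rfl⟩
    rcases tip_eq_iff.1 hw with e | ⟨g, hg, ht⟩
    · left
      rw [(Prod.mk.inj e).2]
    · exact Or.inr ⟨g, K.rotate (K.swap ht)⟩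
  hor_src := by
    rintro _ _ _ ⟨s, a, b, ha, hb, rfl, rfl, h⟩
    exact (K.tri_src h).2
  hor_unique := NextHor.unique
  hor_symm := NextHor.symm
  hor_not_down := NextHor.not_nextDown
  hor_down := by
    rintro _ _ _ ⟨s, a, b, ha, hb, rfl, rfl, h⟩
    exact ⟨_, _, ⟨s, a, ha, rfl, rfl⟩, K.rotate h⟩
  down_transfer := by
    rintro _ _ _ _ _ h ht ⟨s, a, ha, rfl, rfl⟩
    have h1 := K.rotate (K.swap ht)
    rw [K.rev_rev] at h1
    obtain ⟨hc, rfl⟩ := h.move h1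
    exact ⟨s, _, hc, rfl, (K.rev_rev _).symm⟩
  hor_tri := NextHor.tri
  saturated := by
    rintro _ _ e x ⟨s, a, ha, rfl, rfl⟩ ht
    have ht' := K.rotate ht
    rw [K.rev_rev] at ht'
    -- The third side `x` starts at `s`. If it goes up, `e` is horizontal. It cannot go down, being
    -- adjacent to the up arrow `a`. If it is horizontal, `e` is the reverse of the up arrow at the
    -- other end of `x`, so it leads down.
    by_cases hx : L.Up s x
    · exact Or.inr ⟨_, s, a, x, ha, hx, rfl, rfl, ht'⟩
    · left
      have hs : K.src x = L.pr s := (K.tri_src ht').1.symm.trans ha.1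
      have hd : ¬ L.Down s x := fun hd => ha.not_tri_down hd (K.swap ht')
      obtain ⟨t, h⟩ : ∃ t, L.Hor s x t := by
        by_contra! h
        exact hx ⟨hs, hd, h⟩
      refine ⟨t, K.rev e, ha.transfer h (K.swap ht'), ?_, (K.rev_rev e).symm⟩
      exact tip_eq_iff.2 (Or.inr ⟨x, h, K.swap ht'⟩)

end Layer

/-! ### The universal cover and its covering properties -/

/-- The sphere of radius zero. -/
def rootLayer (u : V) : K.Layer where
  S := PUnit
  pr _ := u
  Down _ _ := False
  Hor _ _ _ := False
  down_src := False.elim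
  down_clique := False.elim
  hor_src := False.elim
  hor_unique := False.elim
  hor_symm := False.elim
  hor_not_down := False.elim
  hor_down := False.elim
  down_transfer := False.elim
  hor_tri := False.elim
  saturated := False.elim

/-- The sphere of radius `k` in the universal cover. -/
def layer (u : V) : ℕ → K.Layer
  | 0 => K.rootLayer u
  | k + 1 => (layer u k).next

/-- The universal cover with base point over `u`. -/
def Cover (u : V) : Type v := Σ k, (K.layer u k).S

namespace Cover

variable {K} {u : V}

/-- The covering map. -/
def pr (n : K.Cover u) : V := (K.layer u n.1).pr n.2

/-- The base point. -/
def root : K.Cover u := ⟨0, PUnit.unit⟩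

/-- `Step n a m`: the arrow over `a` starting at `n` ends at `m`. -/
inductive Step : K.Cover u → A → K.Cover u → Prop
  | up {k : ℕ} {s : (K.layer u k).S} {a : A} (h : (K.layer u k).Up s a) :
      Step ⟨k, s⟩ a ⟨k + 1, Layer.tip h⟩
  | hor {k : ℕ} {s t : (K.layer u k).S} {a : A} (h : (K.layer u k).Hor s a t) :
      Step ⟨k, s⟩ a ⟨k, t⟩
  | down {k : ℕ} {s : (K.layer u k).S} {a : A} (h : (K.layer u k).Up s a) :
      Step ⟨k + 1, Layer.tip h⟩ (K.rev a) ⟨k, s⟩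

theorem Step.symm {n m : K.Cover u} {a : A} (h : Step n a m) : Step m (K.rev a) n := by
  cases h with
  | up h => exact .down h
  | hor h => exact .hor (Layer.hor_symm _ h)
  | down h => rw [K.rev_rev]; exact .up h

theorem Step.src {n m : K.Cover u} {a : A} (h : Step n a m) : K.src a = n.pr := by
  cases h with
  | up h => exact h.1
  | hor h => exact (Layer.hor_src _ h).1
  | down h => exact K.src_rev _

theorem Step.tgt {n m : K.Cover u} {a : A} (h : Step n a m) : K.tgt a = m.pr := by
  rw [← K.src_rev]
  exact h.symm.src

/-- `Up` is by definition everything that starts at the right place and is neither `Down` nor `Hor`,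
so the three kinds of steps cover all arrows. -/
theorem exists_step (n : K.Cover u) {a : A} (h : K.src a = n.pr) : ∃ m, Step n a m := by
  obtain ⟨k, s⟩ := n
  by_cases hu : (K.layer u k).Up s a
  · exact ⟨_, .up hu⟩
  by_cases hd : (K.layer u k).Down s a
  · cases k with
    | zero => exact hd.elim
    | succ k =>
      obtain ⟨t, b, hb, rfl, rfl⟩ := hd
      exact ⟨_, .down hb⟩
  · obtain ⟨t, ht⟩ : ∃ t, (K.layer u k).Hor s a t := by
      by_contra! h'
      exact hu ⟨h, hd, h'⟩
    exact ⟨_, .hor ht⟩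

theorem step_iff {k : ℕ} {s : (K.layer u k).S} {a : A} {m : K.Cover u} :
    Step ⟨k, s⟩ a m ↔ (∃ h : (K.layer u k).Up s a, m = ⟨k + 1, Layer.tip h⟩) ∨
      (∃ t, (K.layer u k).Hor s a t ∧ m = ⟨k, t⟩) ∨
      ((K.layer u k).Down s a ∧ Step m (K.rev a) ⟨k, s⟩ ∧ m.1 + 1 = k) := by
  constructor
  · intro h
    generalize hn : (⟨k, s⟩ : K.Cover u) = n at h
    cases h with
    | up h =>
      cases hn
      exact Or.inl ⟨h, rfl⟩
    | hor h =>
      cases hn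
      exact Or.inr (Or.inl ⟨_, h, rfl⟩)
    | down h =>
      cases hn
      exact Or.inr (Or.inr ⟨⟨_, _, h, rfl, rfl⟩, by rw [K.rev_rev]; exact .up h, rfl⟩)
  · rintro (⟨h, rfl⟩ | ⟨t, h, rfl⟩ | ⟨-, h, -⟩)
    · exact .up h
    · exact .hor h
    · have := h.symm
      rwa [K.rev_rev] at this

theorem step_down_iff {k : ℕ} {s : (K.layer u k).S} {a : A} (ha : (K.layer u k).Up s a)
    {d : A} {m : K.Cover u} (hd : (K.layer u (k + 1)).Down (Layer.tip ha) d) :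
    Step ⟨k + 1, Layer.tip ha⟩ d m ↔ ∃ t b, (K.layer u k).Up t b ∧ m = ⟨k, t⟩ ∧ d = K.rev b ∧
      (K.layer u k).Same (s, a) (t, b) := by
  constructor
  · intro h
    rcases step_iff.1 h with ⟨hu, -⟩ | ⟨t, hh, -⟩ | ⟨-, hs, hk⟩
    · exact absurd hd hu.2.1
    · exact absurd hd (Layer.hor_not_down _ hh)
    · obtain ⟨j, t⟩ := m
      obtain rfl : j = k := by simpa using hk
      rcases step_iff.1 hs with ⟨hu, e⟩ | ⟨t, hh, e⟩ | ⟨-, hs', hk'⟩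
      · refine ⟨t, _, hu, rfl, (K.rev_rev d).symm,
          (Layer.tip_eq_iff (ha := ha) (hb := hu)).1 ?_⟩
        exact eq_of_heq (Sigma.mk.inj_iff.1 e).2
      · cases e
      · simp only at hk'
        omega
  · rintro ⟨t, b, hb, rfl, rfl, h⟩
    rw [Layer.tip_eq_iff.2 h]
    exact .down hb

theorem Step.unique {n m m' : K.Cover u} {a : A} (h : Step n a m) (h' : Step n a m') : m = m' := by
  obtain ⟨k, s⟩ := n
  have aux : (K.layer u k).Down s a → m = m' := by
    intro hd
    cases k with
    | zero => exact hd.elim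
    | succ k =>
      obtain ⟨s, b, hb, rfl, rfl⟩ := hd
      have hd' : (K.layer u (k + 1)).Down (Layer.tip hb) (K.rev b) := ⟨s, b, hb, rfl, rfl⟩
      obtain ⟨t, c, hc, rfl, e, hs⟩ := (step_down_iff hb hd').1 h
      obtain ⟨t', c', hc', rfl, e', hs'⟩ := (step_down_iff hb hd').1 h'
      obtain rfl : c = c' := by rw [← K.rev_rev c, ← e, e', K.rev_rev]
      -- Two representatives of one vertex with the same arrow coincide: a horizontal arrow between
      -- them would make that arrow adjacent to itself in a link.
      rcases hs.symm.trans hb hs' with e | ⟨g, hg, ht⟩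
      · rw [(Prod.mk.inj e).1]
      · exact absurd (K.rotate (K.swap ht)) (K.irrefl _ _)
  rcases step_iff.1 h with ⟨hu, e⟩ | ⟨t, ht, e⟩ | ⟨hd, -⟩
  · rcases step_iff.1 h' with ⟨hu', e'⟩ | ⟨t', ht', e'⟩ | ⟨hd', -⟩
    · rw [e, e']
    · exact absurd ht' (hu.2.2 _)
    · exact aux hd'
  · rcases step_iff.1 h' with ⟨hu', e'⟩ | ⟨t', ht', e'⟩ | ⟨hd', -⟩
    · exact absurd ht (hu'.2.2 _)
    · rw [e, e', Layer.hor_unique _ ht ht']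
    · exact aux hd'
  · exact aux hd

theorem Step.rev_iff {n m : K.Cover u} {a : A} : Step n (K.rev a) m ↔ Step m a n :=
  ⟨fun h => by simpa only [K.rev_rev] using h.symm, Step.symm⟩

/-- Triangles lift. An up side and a down side are never adjacent. Two up sides give a horizontal
third side by the definition of `NextHor`, an up and a horizontal side give two arrows with the same
end, and two down sides come from two representatives of one vertex. The remaining cases are
`hor_tri` and `NextHor.move`. -/
theorem Step.tri {n m r : K.Cover u} {a b c : A} (h : Step n a m) (h' : Step n b r)
    (ht : K.Tri a b c) : Step m c r := by
  obtain ⟨k, s⟩ := n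
  have hor_up : ∀ {a b c : A} {m r : K.Cover u} {t}, (K.layer u k).Hor s a t → m = ⟨k, t⟩ →
      (K.layer u k).Up s b → Step ⟨k, s⟩ b r → K.Tri a b c → Step m c r := by
    rintro a b c _ r t ha rfl hb h' ht
    obtain rfl := h'.unique (.up hb)
    have hc := hb.transfer ha ht
    have : Layer.tip hb = Layer.tip hc := Layer.tip_eq_iff.2 (Or.inr ⟨a, ha, ht⟩)
    rw [this]
    exact .up hc
  have hor_down : ∀ {a b c : A} {m r : K.Cover u} {t}, (K.layer u k).Hor s a t → m = ⟨k, t⟩ →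
      (K.layer u k).Down s b → Step ⟨k, s⟩ b r → K.Tri a b c → Step m c r := by
    rintro a b c _ r t ha rfl hb h' ht
    cases k with
    | zero => exact hb.elim
    | succ k =>
      obtain ⟨s, d, hd, rfl, rfl⟩ := hb
      obtain rfl := h'.unique (.down hd)
      have h1 := K.rotate (K.swap ht)
      rw [K.rev_rev] at h1
      obtain ⟨hc, rfl⟩ := Layer.NextHor.move ha h1
      exact Step.rev_iff.1 (.up hc)
  rcases step_iff.1 h with ⟨hu, e⟩ | ⟨t, hh, e⟩ | ⟨hd, -⟩
  · rcases step_iff.1 h' with ⟨hu', e'⟩ | ⟨t', hh', e'⟩ | ⟨hd', -⟩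
    · rw [e, e']
      exact .hor ⟨s, a, b, hu, hu', rfl, rfl, ht⟩
    · exact Step.rev_iff.1 (hor_up hh' e' hu h (K.swap ht))
    · exact absurd (K.swap ht) (hu.not_tri_down hd')
  · rcases step_iff.1 h' with ⟨hu', e'⟩ | ⟨t', hh', e'⟩ | ⟨hd', -⟩
    · exact hor_up hh e hu' h' ht
    · rw [e, e']
      exact .hor (Layer.hor_tri _ hh hh' ht)
    · exact hor_down hh e hd' h' ht
  · rcases step_iff.1 h' with ⟨hu', e'⟩ | ⟨t', hh', e'⟩ | ⟨hd', -⟩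
    · exact absurd ht (hu'.not_tri_down hd)
    · exact Step.rev_iff.1 (hor_down hh' e' hd h (K.swap ht))
    · cases k with
      | zero => exact hd.elim
      | succ k =>
        obtain ⟨s, p, hp, rfl, rfl⟩ := hd
        obtain rfl := h.unique (.down hp)
        obtain ⟨t, q, hq, rfl, rfl, hs⟩ := (step_down_iff hp hd').1 h'
        rcases hs with e | ⟨g, hg, hpq⟩
        · rw [(Prod.mk.inj e).2] at ht
          exact absurd ht (K.irrefl _ _)
        · rw [K.unique ht (K.rotate (K.swap hpq))]
          exact .hor hg

theorem Step.level_le {n m : K.Cover u} {a : A} (h : Step n a m) : m.1 ≤ n.1 + 1 := by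
  cases h with
  | up h => exact le_rfl
  | hor h => exact Nat.le_succ _
  | down h => exact Nat.le_add_right _ 2

theorem exists_down (n : K.Cover u) (h : n.1 ≠ 0) : ∃ a m, Step n a m ∧ m.1 + 1 = n.1 := by
  obtain ⟨k, s⟩ := n
  cases k with
  | zero => exact absurd rfl h
  | succ k =>
    obtain ⟨t, a, ha, rfl⟩ := Layer.exists_tip s
    exact ⟨_, _, .down ha, rfl⟩

theorem eq_root {n : K.Cover u} (h : n.1 = 0) : n = root := by
  obtain ⟨k, s⟩ := n
  obtain rfl : k = 0 := h
  rfl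

/-- Arrows from a vertex to vertices closer to the base point are equal or adjacent in the link. -/
theorem Step.down_clique {n m m' : K.Cover u} {a a' : A} (h : Step n a m) (h' : Step n a' m')
    (hm : m.1 + 1 = n.1) (hm' : m'.1 + 1 = n.1) : m = m' ∨ ∃ c, Step m c m' := by
  obtain ⟨k, s⟩ := n
  have aux : ∀ {a : A} {m : K.Cover u}, Step ⟨k, s⟩ a m → m.1 + 1 = k →
      (K.layer u k).Down s a := by
    intro a m h hm
    rcases step_iff.1 h with ⟨hu, rfl⟩ | ⟨t, hh, rfl⟩ | ⟨hd, -⟩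
    · simp only at hm
      omega
    · simp only at hm
      omega
    · exact hd
  rcases Layer.down_clique _ (aux h hm) (aux h' hm') with rfl | ⟨c, ht⟩
  · exact Or.inl (h.unique h')
  · exact Or.inr ⟨c, h.tri h' ht⟩

/-- The ends of an arrow inside a sphere have a common neighbour closer to the base point. -/
theorem Step.common_down {n m : K.Cover u} {a : A} (h : Step n a m) (hm : m.1 = n.1) :
    ∃ b c r, Step n b r ∧ Step m c r ∧ r.1 + 1 = n.1 := by
  obtain ⟨k, s⟩ := n
  rcases step_iff.1 h with ⟨hu, rfl⟩ | ⟨t, hh, rfl⟩ | ⟨hd, -, h'⟩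
  · simp only at hm
    omega
  · obtain ⟨d, x, hd, ht⟩ := Layer.hor_down _ hh
    cases k with
    | zero => exact hd.elim
    | succ k =>
      obtain ⟨s, b, hb, rfl, rfl⟩ := hd
      exact ⟨_, _, _, .down hb, h.tri (.down hb) (K.swap ht), rfl⟩
  · simp only at hm
    omega

theorem up_root {a : A} (h : K.src a = u) : (K.layer u 0).Up PUnit.unit a :=
  ⟨h, fun h => h, fun _ h => h⟩

/-- An arrow inside the sphere of radius one comes from a triangle. -/
theorem tri_of_step_of_root {a b c : A} {m r : K.Cover u} (h : Step root a m) (h' : Step root b r)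
    (hc : Step m c r) : K.Tri a b c := by
  have ha := up_root h.src
  have hb := up_root h'.src
  obtain rfl := h.unique (.up ha)
  obtain rfl := h'.unique (.up hb)
  rcases step_iff.1 hc with ⟨hu, e⟩ | ⟨t, hh, e⟩ | ⟨hd, -, e⟩
  · exact absurd (congrArg Sigma.fst e) (by simp)
  · obtain ⟨s, p, q, hp, hq, h1, h2, ht⟩ := hh
    cases e
    rcases Layer.tip_eq_iff.1 h1 with e | ⟨_, e, -⟩
    · rcases Layer.tip_eq_iff.1 h2 with e' | ⟨_, e', -⟩
      · obtain rfl : a = p := (Prod.mk.inj e).2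
        obtain rfl : b = q := (Prod.mk.inj e').2
        exact ht
      · exact e'.elim
    · exact e.elim
  · simp at e

theorem Step.ne_root {a : A} {m : K.Cover u} (h : Step root a m) : m ≠ root := by
  rw [h.unique (.up (up_root h.src))]
  intro e
  exact absurd (congrArg Sigma.fst e) (by simp [root])

end Cover

/-! ### Complexes with trivial universal covers -/

/-- The graph of the arrows of the complex. -/
def graph : SimpleGraph V where
  Adj x y := x ≠ y ∧ ∃ a, K.src a = x ∧ K.tgt a = y
  symm := ⟨fun _ _ ⟨h, a, hx, hy⟩ =>
    ⟨h.symm, K.rev a, (K.src_rev a).trans hy, (K.tgt_rev a).trans hx⟩⟩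
  loopless := ⟨fun _ h => h.1 rfl⟩

variable {K}

open Cover in
/-- If the universal covers are trivial, then the graph of a locally `6`-large complex is bridged
and has thin intervals. -/
theorem isThinSystolic_graph [Nonempty V] (hK : ∀ u, Function.Bijective (pr : K.Cover u → V)) :
    K.graph.IsThinSystolic := by
  -- The lift at the root of a loop would end at another vertex over the same base point.
  have ne : ∀ a, K.src a ≠ K.tgt a := by
    intro a e
    obtain ⟨m, hm⟩ := exists_step (root : K.Cover (K.src a)) (a := a) rfl
    refine hm.ne_root ((hK _).1 ?_)
    rw [← hm.tgt, ← e]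
    rfl
  have adj_iff : ∀ {u} {n m : K.Cover u}, K.graph.Adj n.pr m.pr ↔ ∃ a, Step n a m := by
    intro u n m
    constructor
    · rintro ⟨-, a, ha, hb⟩
      obtain ⟨r, hr⟩ := exists_step n ha
      obtain rfl : r = m := (hK u).1 (by rw [← hr.tgt, hb])
      exact ⟨a, hr⟩
    · rintro ⟨a, h⟩
      refine ⟨?_, a, h.src, h.tgt⟩
      rw [← h.src, ← h.tgt]
      exact ne a
  -- With the base point at `v` the arrows end on the sphere of radius one, and an arrow between
  -- their ends comes from a triangle. Thus adjacent neighbours of `v` are adjacent in its link, and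
  -- the link conditions become conditions on the graph.
  have tri : ∀ {v : V} {a b : A}, K.src a = v → K.src b = v → K.graph.Adj (K.tgt a) (K.tgt b) →
      ∃ c, K.Tri a b c := by
    intro v a b ha hb h
    obtain ⟨m, hm⟩ := exists_step (root : K.Cover v) ha
    obtain ⟨r, hr⟩ := exists_step (root : K.Cover v) hb
    rw [hm.tgt, hr.tgt] at h
    obtain ⟨c, hc⟩ := adj_iff.1 h
    exact ⟨c, tri_of_step_of_root hm hr hc⟩
  have arrow : ∀ {v a : V}, K.graph.Adj v a → ∃ α, K.src α = v ∧ K.tgt α = a := fun h => h.2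
  have adj : ∀ {a b c : A}, K.Tri a b c → K.graph.Adj (K.tgt a) (K.tgt b) := by
    intro a b c h
    obtain ⟨-, h1, h2⟩ := K.tri_src h
    exact ⟨by rw [← h1, ← h2]; exact ne c, c, h1, h2⟩
  have reach : ∀ u k (n : K.Cover u), n.1 = k → ∃ p : K.graph.Walk u n.pr, p.length = k := by
    intro u k
    induction k with
    | zero =>
      intro n hn
      obtain rfl := eq_root hn
      exact ⟨.nil, rfl⟩
    | succ k ih =>
      intro n hn
      obtain ⟨a, m, h, hm⟩ := exists_down n (by omega)
      obtain ⟨p, hp⟩ := ih m (by omega)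
      exact ⟨p.concat (adj_iff.2 ⟨_, h.symm⟩), by simp [hp]⟩
  have conn : K.graph.Connected := by
    refine ⟨fun u v => ?_⟩
    obtain ⟨n, rfl⟩ := (hK u).2 v
    obtain ⟨p, -⟩ := reach u _ n rfl
    exact ⟨p⟩
  -- Descending to the root gives a path whose length is the radius; conversely the radius grows by
  -- at most one along each edge.
  have dist : ∀ {u} (n : K.Cover u), K.graph.dist u n.pr = n.1 := by
    intro u n
    obtain ⟨p, hp⟩ := reach u _ n rfl
    refine le_antisymm (hp ▸ SimpleGraph.dist_le p) ?_
    obtain ⟨φ, hφ⟩ := (hK u).2.hasRightInverse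
    have h := SimpleGraph.dist_le_of_lipschitz conn (fun v => (φ v).1) (by
      intro x y hxy
      rw [← hφ x, ← hφ y] at hxy
      obtain ⟨a, ha⟩ := adj_iff.1 hxy
      exact ha.level_le) u n.pr
    have h1 : φ n.pr = n := (hK u).1 (hφ _)
    have h2 : φ u = root := (hK u).1 (hφ _)
    simp only [h1, h2] at h
    simpa [root] using h
  refine ⟨conn, ?_, ?_, ?_, ?_, ?_⟩
  · intro u w x y hx hy hdx hdy
    obtain ⟨n, rfl⟩ := (hK u).2 w
    obtain ⟨m, rfl⟩ := (hK u).2 x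
    obtain ⟨r, rfl⟩ := (hK u).2 y
    obtain ⟨a, ha⟩ := adj_iff.1 hx
    obtain ⟨b, hb⟩ := adj_iff.1 hy
    rw [dist, dist] at hdx hdy
    rcases ha.down_clique hb hdx hdy with rfl | h
    · exact Or.inl rfl
    · exact Or.inr (adj_iff.2 h)
  · intro u w x hx hd
    obtain ⟨n, rfl⟩ := (hK u).2 w
    obtain ⟨m, rfl⟩ := (hK u).2 x
    obtain ⟨a, ha⟩ := adj_iff.1 hx
    rw [dist, dist] at hd
    obtain ⟨b, c, r, hb, hc, hr⟩ := ha.common_down hd.symm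
    exact ⟨r.pr, adj_iff.2 ⟨b, hb⟩, adj_iff.2 ⟨c, hc⟩, by rw [dist, dist, hr]⟩
  · intro v a b c d ha hb hc hd hab hbc hcd hda
    obtain ⟨α, hα, rfl⟩ := arrow ha
    obtain ⟨β, hβ, rfl⟩ := arrow hb
    obtain ⟨γ, hγ, rfl⟩ := arrow hc
    obtain ⟨δ, hδ, rfl⟩ := arrow hd
    obtain ⟨_, h1⟩ := tri hα hβ hab
    obtain ⟨_, h2⟩ := tri hβ hγ hbc
    obtain ⟨_, h3⟩ := tri hγ hδ hcd
    obtain ⟨_, h4⟩ := tri hδ hα hda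
    rcases K.square h1 h2 h3 h4 with rfl | rfl | ⟨_, h⟩ | ⟨_, h⟩
    · exact Or.inl rfl
    · exact Or.inr (Or.inl rfl)
    · exact Or.inr (Or.inr (Or.inl (adj h)))
    · exact Or.inr (Or.inr (Or.inr (adj h)))
  · intro v a b c d e ha hb hc hd he hab hbc hcd hde hea
    obtain ⟨α, hα, rfl⟩ := arrow ha
    obtain ⟨β, hβ, rfl⟩ := arrow hb
    obtain ⟨γ, hγ, rfl⟩ := arrow hc
    obtain ⟨δ, hδ, rfl⟩ := arrow hd
    obtain ⟨ε, hε, rfl⟩ := arrow he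
    obtain ⟨_, h1⟩ := tri hα hβ hab
    obtain ⟨_, h2⟩ := tri hβ hγ hbc
    obtain ⟨_, h3⟩ := tri hγ hδ hcd
    obtain ⟨_, h4⟩ := tri hδ hε hde
    obtain ⟨_, h5⟩ := tri hε hα hea
    refine (K.pentagon h1 h2 h3 h4 h5).imp (congrArg _) <| Or.imp (congrArg _) <|
      Or.imp (congrArg _) <| Or.imp (congrArg _) <| Or.imp (congrArg _) <|
      Or.imp ?_ <| Or.imp ?_ <| Or.imp ?_ <| Or.imp ?_ ?_ <;> exact fun ⟨_, h⟩ => adj h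
  · intro a b c x y hab hac hbc hxa hxb hxc hya hyb hyc
    obtain ⟨β, hβ, rfl⟩ := arrow hab
    obtain ⟨γ, hγ, rfl⟩ := arrow hac
    obtain ⟨ξ, hξ, rfl⟩ := arrow hxa.symm
    obtain ⟨η, hη, rfl⟩ := arrow hya.symm
    obtain ⟨_, h1⟩ := tri hβ hγ hbc
    obtain ⟨_, h2⟩ := tri hβ hξ hxb.symm
    obtain ⟨_, h3⟩ := tri hγ hξ hxc.symm
    obtain ⟨_, h4⟩ := tri hβ hη hyb.symm
    obtain ⟨_, h5⟩ := tri hγ hη hyc.symm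
    rcases K.diamond h1 h2 h3 h4 h5 with rfl | ⟨_, h⟩
    · exact Or.inl rfl
    · exact Or.inr (adj h)

end TriangleComplex

/-! ### The thickening as a triangle complex -/

namespace Graphical

open SimpleGraph TriangleComplex

variable {V : Type u} {W : Type v} {Θ : SimpleGraph V} {Ω : SimpleGraph W}

/-- The edge from `f y` to `t` has a lift starting at `y`. -/
def HasLift (f : Ω →g Θ) (y : W) (t : V) : Prop := ∃ z, Ω.Adj y z ∧ f z = t

/-- The links of the vertices of the complex have girth at least six: there `f` is locally
injective, and a vertex `y` of `Ω` over `v` is seen as a hyperedge of the link of `v`. -/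
structure LinkGirthSix (f : Ω →g Θ) : Prop where
  locally_injective : ∀ {y z z'}, Ω.Adj y z → Ω.Adj y z' → f z = f z' → z = z'
  no_bigon : ∀ {y₁ y₂ s t}, f y₁ = f y₂ → y₁ ≠ y₂ → s ≠ t → HasLift f y₁ s → HasLift f y₂ s →
    HasLift f y₁ t → ¬ HasLift f y₂ t
  no_triangle : ∀ {y₁ y₂ y₃ r s t}, f y₁ = f y₂ → f y₂ = f y₃ → y₁ ≠ y₂ → y₂ ≠ y₃ → y₃ ≠ y₁ →
    r ≠ s → s ≠ t → t ≠ r → HasLift f y₁ r → HasLift f y₂ r → HasLift f y₂ s → HasLift f y₃ s →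
    HasLift f y₃ t → ¬ HasLift f y₁ t
  no_square : ∀ {y₁ y₂ y₃ y₄ r s t p}, f y₁ = f y₂ → f y₂ = f y₃ → f y₃ = f y₄ → y₁ ≠ y₂ →
    y₂ ≠ y₃ → y₃ ≠ y₄ → y₄ ≠ y₁ → r ≠ s → s ≠ t → t ≠ p → p ≠ r →
    HasLift f y₁ r → HasLift f y₂ r → HasLift f y₂ s → HasLift f y₃ s →
    HasLift f y₃ t → HasLift f y₄ t → HasLift f y₄ p → ¬ HasLift f y₁ p
  no_pentagon : ∀ {y₁ y₂ y₃ y₄ y₅ r s t p q}, f y₁ = f y₂ → f y₂ = f y₃ → f y₃ = f y₄ →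
    f y₄ = f y₅ → y₁ ≠ y₂ → y₂ ≠ y₃ → y₃ ≠ y₄ → y₄ ≠ y₅ → y₅ ≠ y₁ →
    r ≠ s → s ≠ t → t ≠ p → p ≠ q → q ≠ r →
    HasLift f y₁ r → HasLift f y₂ r → HasLift f y₂ s → HasLift f y₃ s →
    HasLift f y₃ t → HasLift f y₄ t → HasLift f y₄ p → HasLift f y₅ p →
    HasLift f y₅ q → ¬ HasLift f y₁ q

/-- The arrows of the thickening: edges of `Θ` and diagonals of the components of `Ω`. -/
inductive Arrow (f : Ω →g Θ) : Type (max u v)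
  | edge {x y : V} (h : Θ.Adj x y)
  | diag (y z : W) (hne : y ≠ z) (hr : Ω.Reachable y z) (hna : ¬ Ω.Adj y z)

namespace Arrow

variable {f : Ω →g Θ}

/-- The initial vertex of an arrow. -/
def src : Arrow f → V
  | @edge _ _ _ _ _ x _ _ => x
  | diag y _ _ _ _ => f y

/-- The terminal vertex of an arrow. -/
def tgt : Arrow f → V
  | @edge _ _ _ _ _ _ y _ => y
  | diag _ z _ _ _ => f z

/-- The reversed arrow. -/
def rev : Arrow f → Arrow f
  | edge h => edge h.symm
  | diag y z hne hr hna => diag z y hne.symm hr.symm fun h => hna h.symm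

/-- `a.Joins y z`: the arrow `a` joins the images of the vertices `y` and `z` of a component. -/
inductive Joins : Arrow f → W → W → Prop
  | edge {y z : W} (h : Ω.Adj y z) : Joins (edge (f.map_adj h)) y z
  | diag (y z : W) (hne : y ≠ z) (hr : Ω.Reachable y z) (hna : ¬ Ω.Adj y z) :
      Joins (diag y z hne hr hna) y z

theorem exists_joins (f : Ω →g Θ) {y z : W} (hne : y ≠ z) (hr : Ω.Reachable y z) :
    ∃ a : Arrow f, a.Joins y z := by
  by_cases h : Ω.Adj y z
  · exact ⟨_, .edge h⟩
  · exact ⟨_, .diag y z hne hr h⟩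

namespace Joins

variable {a b : Arrow f} {y z y' z' : W}

theorem ne (h : a.Joins y z) : y ≠ z := by
  cases h with
  | edge h => exact h.ne
  | diag _ _ h => exact h

theorem reachable (h : a.Joins y z) : Ω.Reachable y z := by
  cases h with
  | edge h => exact h.reachable
  | diag _ _ _ h => exact h

theorem src_eq (h : a.Joins y z) : a.src = f y := by
  cases h <;> rfl

theorem tgt_eq (h : a.Joins y z) : a.tgt = f z := by
  cases h <;> rfl

theorem rev (h : a.Joins y z) : a.rev.Joins z y := by
  cases h with
  | edge h => exact .edge h.symm
  | diag _ _ h1 h2 h3 => exact .diag _ _ h1.symm h2.symm _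

theorem eq (h : a.Joins y z) (h' : b.Joins y z) : a = b := by
  cases h with
  | edge h =>
    cases h' with
    | edge => rfl
    | diag _ _ _ _ h' => exact absurd h h'
  | diag _ _ _ _ h =>
    cases h' with
    | edge h' => exact absurd h' h
    | diag => rfl

/-- A diagonal remembers its ends in `Ω`. Only an edge of `Θ` can be seen from two vertices of `Ω`,
and then it lifts at both. -/
theorem adj_of_ne (hy : y ≠ y') (h : a.Joins y z) (h' : a.Joins y' z') :
    Ω.Adj y z ∧ Ω.Adj y' z' := by
  cases h with
  | edge h =>
    generalize ha : (Arrow.edge (f.map_adj h) : Arrow f) = a at h'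
    cases h' with
    | edge h' => exact ⟨h, h'⟩
    | diag => cases ha
  | diag _ _ _ _ h =>
    cases h'
    exact absurd rfl hy

theorem hasLift (hy : y ≠ y') (h : a.Joins y z) (h' : a.Joins y' z') :
    HasLift f y a.tgt ∧ HasLift f y' a.tgt := by
  obtain ⟨h1, h2⟩ := adj_of_ne hy h h'
  exact ⟨⟨z, h1, h.tgt_eq.symm⟩, ⟨z', h2, h'.tgt_eq.symm⟩⟩

theorem right_unique (hf : LinkGirthSix f) (h : a.Joins y z) (h' : a.Joins y z') : z = z' := by
  cases h with
  | edge h =>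
    generalize ha : (Arrow.edge (f.map_adj h) : Arrow f) = a at h'
    have e := h'.tgt_eq
    cases h' with
    | edge h' =>
      rw [← ha] at e
      exact hf.locally_injective h h' e
    | diag => cases ha
  | diag _ _ _ _ h =>
    cases h'
    rfl

end Joins

/-- Triangles of arrows inside a component. -/
def Tri (a b c : Arrow f) : Prop := ∃ y z z', a.Joins y z ∧ b.Joins y z' ∧ c.Joins z z'

theorem tri_of_joins {a b : Arrow f} {y z z' : W} (ha : a.Joins y z) (hb : b.Joins y z')
    (hne : z ≠ z') : ∃ c, Tri a b c ∧ c.Joins z z' := by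
  obtain ⟨c, hc⟩ := exists_joins f hne (ha.reachable.symm.trans hb.reachable)
  exact ⟨c, ⟨y, z, z', ha, hb, hc⟩, hc⟩

theorem eq_or_tri {a b : Arrow f} {y z z' : W} (ha : a.Joins y z) (hb : b.Joins y z') :
    a = b ∨ ∃ c, Tri a b c := by
  by_cases h : z = z'
  · subst h
    exact Or.inl (ha.eq hb)
  · obtain ⟨c, hc, -⟩ := tri_of_joins ha hb h
    exact Or.inr ⟨c, hc⟩

/-- Two arrows shared by the corners `y` and `x` would be edges that lift at both, a bigon in the
link. Hence a triangle is determined by two of its sides. -/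
theorem corner_unique (hf : LinkGirthSix f) {a b : Arrow f} {y z z' x w w' : W}
    (ha : a.Joins y z) (hb : b.Joins y z') (hne : z ≠ z') (ha' : a.Joins x w)
    (hb' : b.Joins x w') : y = x := by
  by_contra h
  have h1 := ha.hasLift h ha'
  have h2 := hb.hasLift h hb'
  refine hf.no_bigon (ha.src_eq.symm.trans ha'.src_eq) h ?_ h1.1 h1.2 h2.1 h2.2
  rw [ha.tgt_eq, hb.tgt_eq]
  exact fun e => hne (hf.locally_injective (ha.adj_of_ne h ha').1 (hb.adj_of_ne h hb').1 e)

theorem not_tri_self (hf : LinkGirthSix f) (a c : Arrow f) : ¬ Tri a a c := by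
  rintro ⟨y, z, z', h, h', hc⟩
  exact hc.ne (h.right_unique hf h')

theorem Tri.unique (hf : LinkGirthSix f) {a b c c' : Arrow f} (h : Tri a b c)
    (h' : Tri a b c') : c = c' := by
  obtain ⟨y, z, z', ha, hb, hc⟩ := h
  obtain ⟨x, w, w', ha', hb', hc'⟩ := h'
  obtain rfl := corner_unique hf ha hb hc.ne ha' hb'
  obtain rfl := ha.right_unique hf ha'
  obtain rfl := hb.right_unique hf hb'
  exact hc.eq hc'

/-- Two arrows at the same corner that also lie at other corners have different ends. -/
theorem tgt_ne_of_shared (hf : LinkGirthSix f) {a b : Arrow f} {x y y' z z' w w' : W}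
    (ha : a.Joins y z) (hb : b.Joins y z') (hne : z ≠ z') (hx : y ≠ x) (hy : y ≠ y')
    (ha' : a.Joins x w) (hb' : b.Joins y' w') : a.tgt ≠ b.tgt := by
  rw [ha.tgt_eq, hb.tgt_eq]
  exact fun e => hne (hf.locally_injective (ha.adj_of_ne hx ha').1 (hb.adj_of_ne hy hb').1 e)

/-- A Helly property of the link: three arrows that are pairwise at a common corner are all at the
corner `y`. If the three corners were different, the shared arrows would be edges and give a
triangle in the link. -/
theorem third_joins (hf : LinkGirthSix f) {a b d e g : Arrow f} {y z z' : W}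
    (ha : a.Joins y z) (hb : b.Joins y z') (hne : z ≠ z') (h1 : Tri a d e) (h2 : Tri b d g) :
    ∃ w, d.Joins y w := by
  obtain ⟨y₁, z₁, w₁, ha₁, hd₁, he⟩ := h1
  obtain ⟨y₂, z₂, w₂, hb₂, hd₂, hg⟩ := h2
  by_cases e1 : y = y₁
  · subst e1
    exact ⟨_, hd₁⟩
  by_cases e2 : y = y₂
  · subst e2
    exact ⟨_, hd₂⟩
  by_cases e3 : y₁ = y₂
  · subst e3
    exact absurd (corner_unique hf ha hb hne ha₁ hb₂) e1
  exfalso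
  have l1 := ha.hasLift e1 ha₁
  have l2 := hd₁.hasLift e3 hd₂
  have l3 := hb₂.hasLift (Ne.symm e2) hb
  exact hf.no_triangle (ha.src_eq.symm.trans ha₁.src_eq) (hd₁.src_eq.symm.trans hd₂.src_eq) e1 e3
    (Ne.symm e2) (tgt_ne_of_shared hf ha₁ hd₁ he.ne (Ne.symm e1) e3 ha hd₂)
    (tgt_ne_of_shared hf hb₂ hd₂ hg.ne (Ne.symm e2) (Ne.symm e3) hb hd₁).symm
    (tgt_ne_of_shared hf ha hb hne e1 e2 ha₁ hb₂).symm
    l1.1 l1.2 l2.1 l2.2 l3.1 l3.2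

/-- If two consecutive corners coincide, the outer two of the three arrows there are equal or span a
triangle. Otherwise all four arrows are shared by different corners, hence are edges, and form a
square in the link. The pentagon is treated in the same way. -/
theorem Tri.square (hf : LinkGirthSix f) {a b c d ab bc cd da : Arrow f} : Tri a b ab →
    Tri b c bc → Tri c d cd → Tri d a da →
    a = c ∨ b = d ∨ (∃ x, Tri a c x) ∨ ∃ x, Tri b d x := by
  rintro ⟨y₁, _, _, a₁, b₁, h₁⟩ ⟨y₂, _, _, b₂, c₂, h₂⟩ ⟨y₃, _, _, c₃, d₃, h₃⟩
    ⟨y₄, _, _, d₄, a₄, h₄⟩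
  by_cases e₁ : y₁ = y₂
  · subst e₁
    exact (eq_or_tri a₁ c₂).imp id fun h => Or.inr (Or.inl h)
  by_cases e₂ : y₂ = y₃
  · subst e₂
    exact Or.inr ((eq_or_tri b₂ d₃).imp id Or.inr)
  by_cases e₃ : y₃ = y₄
  · subst e₃
    exact (eq_or_tri a₄ c₃).imp id fun h => Or.inr (Or.inl h)
  by_cases e₄ : y₄ = y₁
  · subst e₄
    exact Or.inr ((eq_or_tri b₁ d₄).imp id Or.inr)
  exfalso
  have l1 := b₁.hasLift e₁ b₂
  have l2 := c₂.hasLift e₂ c₃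
  have l3 := d₃.hasLift e₃ d₄
  have l4 := a₄.hasLift e₄ a₁
  exact hf.no_square (b₁.src_eq.symm.trans b₂.src_eq) (c₂.src_eq.symm.trans c₃.src_eq)
    (d₃.src_eq.symm.trans d₄.src_eq) e₁ e₂ e₃ e₄
    (tgt_ne_of_shared hf b₂ c₂ h₂.ne (Ne.symm e₁) e₂ b₁ c₃)
    (tgt_ne_of_shared hf c₃ d₃ h₃.ne (Ne.symm e₂) e₃ c₂ d₄)
    (tgt_ne_of_shared hf d₄ a₄ h₄.ne (Ne.symm e₃) e₄ d₃ a₁)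
    (tgt_ne_of_shared hf a₁ b₁ h₁.ne (Ne.symm e₄) e₁ a₄ b₂)
    l1.1 l1.2 l2.1 l2.2 l3.1 l3.2 l4.1 l4.2

theorem Tri.pentagon (hf : LinkGirthSix f) {a b c d e ab bc cd de ea : Arrow f} : Tri a b ab →
    Tri b c bc → Tri c d cd → Tri d e de → Tri e a ea →
    a = c ∨ b = d ∨ c = e ∨ d = a ∨ e = b ∨ (∃ x, Tri a c x) ∨ (∃ x, Tri b d x) ∨
      (∃ x, Tri c e x) ∨ (∃ x, Tri d a x) ∨ ∃ x, Tri e b x := by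
  rintro ⟨y₁, _, _, a₁, b₁, h₁⟩ ⟨y₂, _, _, b₂, c₂, h₂⟩
    ⟨y₃, _, _, c₃, d₃, h₃⟩ ⟨y₄, _, _, d₄, x₄, h₄⟩ ⟨y₅, _, _, x₅, a₅, h₅⟩
  by_cases e₁ : y₁ = y₂
  · subst e₁
    exact (eq_or_tri a₁ c₂).elim (fun h => Or.inl h)
      fun h => Or.inr <| Or.inr <| Or.inr <| Or.inr <| Or.inr <| Or.inl h
  by_cases e₂ : y₂ = y₃
  · subst e₂
    exact (eq_or_tri b₂ d₃).elim (fun h => Or.inr <| Or.inl h)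
      fun h => Or.inr <| Or.inr <| Or.inr <| Or.inr <| Or.inr <| Or.inr <| Or.inl h
  by_cases e₃ : y₃ = y₄
  · subst e₃
    exact (eq_or_tri c₃ x₄).elim (fun h => Or.inr <| Or.inr <| Or.inl h)
      fun h => Or.inr <| Or.inr <| Or.inr <| Or.inr <| Or.inr <| Or.inr <| Or.inr <| Or.inl h
  by_cases e₄ : y₄ = y₅
  · subst e₄
    exact (eq_or_tri d₄ a₅).elim (fun h => Or.inr <| Or.inr <| Or.inr <| Or.inl h)
      fun h => Or.inr <| Or.inr <| Or.inr <| Or.inr <| Or.inr <| Or.inr <| Or.inr <|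
        Or.inr <| Or.inl h
  by_cases e₅ : y₅ = y₁
  · subst e₅
    exact (eq_or_tri x₅ b₁).elim (fun h => Or.inr <| Or.inr <| Or.inr <| Or.inr <| Or.inl h)
      fun h => Or.inr <| Or.inr <| Or.inr <| Or.inr <| Or.inr <| Or.inr <| Or.inr <|
        Or.inr <| Or.inr <| h
  exfalso
  have l1 := b₁.hasLift e₁ b₂
  have l2 := c₂.hasLift e₂ c₃
  have l3 := d₃.hasLift e₃ d₄
  have l4 := x₄.hasLift e₄ x₅
  have l5 := a₅.hasLift e₅ a₁
  exact hf.no_pentagon (b₁.src_eq.symm.trans b₂.src_eq) (c₂.src_eq.symm.trans c₃.src_eq)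
    (d₃.src_eq.symm.trans d₄.src_eq) (x₄.src_eq.symm.trans x₅.src_eq) e₁ e₂ e₃ e₄ e₅
    (tgt_ne_of_shared hf b₂ c₂ h₂.ne (Ne.symm e₁) e₂ b₁ c₃)
    (tgt_ne_of_shared hf c₃ d₃ h₃.ne (Ne.symm e₂) e₃ c₂ d₄)
    (tgt_ne_of_shared hf d₄ x₄ h₄.ne (Ne.symm e₃) e₄ d₃ x₅)
    (tgt_ne_of_shared hf x₅ a₅ h₅.ne (Ne.symm e₄) e₅ x₄ a₁)
    (tgt_ne_of_shared hf a₁ b₁ h₁.ne (Ne.symm e₅) e₁ a₅ b₂)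
    l1.1 l1.2 l2.1 l2.2 l3.1 l3.2 l4.1 l4.2 l5.1 l5.2

end Arrow

open Arrow

variable {f : Ω →g Θ}

/-- The complex of triangles of the thickening. -/
def arrowComplex (hf : LinkGirthSix f) : TriangleComplex V (Arrow f) where
  src := Arrow.src
  tgt := Arrow.tgt
  rev := Arrow.rev
  Tri := Arrow.Tri
  rev_rev a := by cases a <;> rfl
  src_rev a := by cases a <;> rfl
  tri_src := by
    rintro _ _ _ ⟨y, z, z', ha, hb, hc⟩
    rw [ha.src_eq, hb.src_eq, ha.tgt_eq, hb.tgt_eq, hc.src_eq, hc.tgt_eq]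
    exact ⟨rfl, rfl, rfl⟩
  swap := by
    rintro _ _ _ ⟨y, z, z', ha, hb, hc⟩
    exact ⟨y, z', z, hb, ha, hc.rev⟩
  rotate := by
    rintro _ _ _ ⟨y, z, z', ha, hb, hc⟩
    exact ⟨z, y, z', ha.rev, hc, hb⟩
  unique := Tri.unique hf
  irrefl := not_tri_self hf
  tetra := by
    rintro a b c d e g ⟨y, z, z', ha, hb, hc⟩ h1 h2
    -- All three arrows start at `y`, so the tetrahedron lies inside one component of `Ω`.
    obtain ⟨w, hd⟩ := third_joins hf ha hb hc.ne h1 h2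
    have hzw : z ≠ w := by
      rintro rfl
      rw [ha.eq hd] at h1
      exact not_tri_self hf _ _ h1
    have hzw' : z' ≠ w := by
      rintro rfl
      rw [hb.eq hd] at h2
      exact not_tri_self hf _ _ h2
    obtain ⟨e', he, he'⟩ := tri_of_joins ha hd hzw
    obtain ⟨g', hg, hg'⟩ := tri_of_joins hb hd hzw'
    rw [h1.unique hf he, h2.unique hf hg]
    exact ⟨z, z', w, hc, he', hg'⟩
  square := Tri.square hf
  pentagon := Tri.pentagon hf
  diamond := by
    rintro a b c d _ _ _ _ _ ⟨y, z, z', ha, hb, h⟩ hac hbc had hbd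
    -- Both `c` and `d` start at the corner `y` determined by `a` and `b`, so they are equal or span
    -- a triangle.
    obtain ⟨w, hc⟩ := third_joins hf ha hb h.ne hac hbc
    obtain ⟨w', hd⟩ := third_joins hf ha hb h.ne had hbd
    exact eq_or_tri hc hd

theorem graph_arrowComplex (hf : LinkGirthSix f) : (arrowComplex hf).graph = thickGraph f := by
  ext x y
  refine and_congr_right fun hxy => ⟨?_, ?_⟩
  · rintro ⟨a, rfl, rfl⟩
    cases a with
    | edge h => exact Or.inl h
    | diag y z hne hr hna =>
      refine Or.inr ⟨Ω.connectedComponentMk y, ⟨y, rfl, rfl⟩, ⟨z, ?_, rfl⟩⟩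
      exact (ConnectedComponent.sound hr).symm
  · rintro (h | ⟨i, ⟨y, hy, rfl⟩, ⟨z, hz, rfl⟩⟩)
    · exact ⟨.edge h, rfl, rfl⟩
    · obtain ⟨a, ha⟩ := exists_joins f (y := y) (z := z) (by rintro rfl; exact hxy rfl)
        (ConnectedComponent.exact (hy.trans hz.symm))
      exact ⟨a, ha.src_eq, ha.tgt_eq⟩

/-! ### Path lifting and triviality of the cover -/

section Transport

variable {hf : LinkGirthSix f} {u : V}

/-- `Lifts p n m`: the lift of the path `p` to the universal cover starting at `n` ends at `m`. -/
def Lifts : ∀ {x y : V}, Θ.Walk x y → (arrowComplex hf).Cover u → (arrowComplex hf).Cover u → Prop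
  | _, _, .nil, n, m => n = m
  | _, _, .cons h p, n, m => ∃ r, Cover.Step n (Arrow.edge h) r ∧ Lifts p r m

theorem Lifts.pr_eq {x y : V} {p : Θ.Walk x y} {n m : (arrowComplex hf).Cover u}
    (h : Lifts p n m) (hn : n.pr = x) : m.pr = y := by
  induction p generalizing n with
  | nil => rwa [← show n = m from h]
  | cons h p ih =>
    obtain ⟨r, hr, h⟩ := h
    exact ih h hr.tgt.symm

theorem exists_lifts {x y : V} (p : Θ.Walk x y) {n : (arrowComplex hf).Cover u} (hn : n.pr = x) :
    ∃ m, Lifts p n m := by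
  induction p generalizing n with
  | nil => exact ⟨n, rfl⟩
  | cons h p ih =>
    obtain ⟨r, hr⟩ := Cover.exists_step n (a := Arrow.edge h) hn.symm
    obtain ⟨m, hm⟩ := ih hr.tgt.symm
    exact ⟨m, r, hr, hm⟩

theorem Lifts.unique {x y : V} {p : Θ.Walk x y} {n m m' : (arrowComplex hf).Cover u}
    (h : Lifts p n m) (h' : Lifts p n m') : m = m' := by
  induction p generalizing n with
  | nil => exact h.symm.trans h'
  | cons _ p ih =>
    obtain ⟨r, hr, h⟩ := h
    obtain ⟨r', hr', h'⟩ := h'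
    obtain rfl := hr.unique hr'
    exact ih h h'

theorem lifts_append {x y z : V} {p : Θ.Walk x y} {q : Θ.Walk y z}
    {n m : (arrowComplex hf).Cover u} :
    Lifts (p.append q) n m ↔ ∃ r, Lifts p n r ∧ Lifts q r m := by
  induction p generalizing n with
  | nil => exact ⟨fun h => ⟨n, rfl, h⟩, fun ⟨r, hr, h⟩ => by rwa [show n = r from hr]⟩
  | cons _ p ih =>
    constructor
    · rintro ⟨r, hr, h⟩
      obtain ⟨s, hs, h⟩ := ih.1 h
      exact ⟨s, ⟨r, hr, hs⟩, h⟩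
    · rintro ⟨s, ⟨r, hr, hs⟩, h⟩
      exact ⟨r, hr, ih.2 ⟨s, hs, h⟩⟩

theorem Lifts.reverse {x y : V} {p : Θ.Walk x y} {n m : (arrowComplex hf).Cover u}
    (h : Lifts p n m) : Lifts p.reverse m n := by
  induction p generalizing n with
  | nil => exact Eq.symm h
  | cons _ p ih =>
    obtain ⟨r, hr, h⟩ := h
    rw [Walk.reverse_cons]
    exact lifts_append.2 ⟨r, ih h, n, hr.symm, rfl⟩

/-- Lifting the image of a path in `Ω`: its end is joined to its beginning by an arrow. -/
theorem exists_lifts_map {w y z : W} (c : Ω.Walk y z) {n m : (arrowComplex hf).Cover u}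
    (hn : n.pr = f w) (h : (y = w ∧ m = n) ∨ ∃ a : Arrow f, a.Joins w y ∧ Cover.Step n a m) :
    ∃ r, Lifts (c.map f) m r ∧
      ((z = w ∧ r = n) ∨ ∃ a : Arrow f, a.Joins w z ∧ Cover.Step n a r) := by
  induction c generalizing m with
  | nil => exact ⟨m, rfl, h⟩
  | @cons y y' z hyy' c ih =>
    suffices hs : ∃ r, Cover.Step m (Arrow.edge (f.map_adj hyy')) r ∧
        ((y' = w ∧ r = n) ∨ ∃ a : Arrow f, a.Joins w y' ∧ Cover.Step n a r) by
      obtain ⟨r, hr, hr'⟩ := hs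
      obtain ⟨s, hs, hs'⟩ := ih hr'
      exact ⟨s, ⟨r, hr, hs⟩, hs'⟩
    rcases h with ⟨rfl, rfl⟩ | ⟨a, ha, hs⟩
    · obtain ⟨r, hr⟩ := Cover.exists_step m (a := Arrow.edge (f.map_adj hyy')) hn.symm
      exact ⟨r, hr, Or.inr ⟨_, .edge hyy', hr⟩⟩
    · by_cases hy' : y' = w
      · subst hy'
        obtain rfl := ha.eq (.edge hyy'.symm)
        exact ⟨n, hs.symm, Or.inl ⟨rfl, rfl⟩⟩
      -- The lift of the edge `y y'` is the third side of the lifted triangle on `w`, `y`, `y'`: the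
      -- path is coned off from `w`.
      · obtain ⟨b, hb⟩ := exists_joins f (Ne.symm hy') (ha.reachable.trans hyy'.reachable)
        obtain ⟨r, hr⟩ := Cover.exists_step n (a := b) (hb.src_eq.trans hn.symm)
        exact ⟨r, hs.tri hr ⟨w, y, y', ha, hb, .edge hyy'⟩, Or.inr ⟨b, hb, hr⟩⟩

/-- At the end of the closed path the alternative is an arrow joining `w` to itself, which does not
exist; so boundaries of `2`-cells lift to closed paths. -/
theorem lifts_map_of_closed {w : W} (c : Ω.Walk w w) {n : (arrowComplex hf).Cover u}
    (hn : n.pr = f w) : Lifts (c.map f) n n := by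
  obtain ⟨r, hr, ⟨-, rfl⟩ | ⟨a, ha, -⟩⟩ := exists_lifts_map c hn (Or.inl ⟨rfl, rfl⟩)
  · exact hr
  · exact absurd rfl ha.ne

theorem lifts_iff_of_homotopic {x y : V} {p q : Θ.Walk x y} (h : Homotopic f p q)
    {n m : (arrowComplex hf).Cover u} (hn : n.pr = x) : Lifts p n m ↔ Lifts q n m := by
  induction h generalizing n m with
  | refl => rfl
  | symm _ ih => exact (ih hn).symm
  | trans _ _ ih ih' => exact (ih hn).trans (ih' hn)
  | backtrack p h q =>
    rw [lifts_append, lifts_append]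
    refine exists_congr fun r => and_congr_right fun hr => ⟨?_, fun hq => ?_⟩
    · rintro ⟨s, hs, t, ht, hq⟩
      obtain rfl := hs.symm.unique ht
      exact hq
    · obtain ⟨s, hs⟩ := Cover.exists_step r (a := Arrow.edge h) (hr.pr_eq hn).symm
      exact ⟨s, hs, r, hs.symm, hq⟩
  | cell c _ p q =>
    rw [lifts_append, lifts_append]
    refine exists_congr fun r => and_congr_right fun hr => ?_
    have hc := lifts_map_of_closed c (hr.pr_eq hn)
    rw [lifts_append]
    constructor
    · rintro ⟨s, hs, hq⟩
      obtain rfl := hc.unique hs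
      exact hq
    · exact fun hq => ⟨r, hc, hq⟩

/-- A diagonal is replaced by the image of any path in `Ω` between its ends; coning it off shows
that its lift has the same end. -/
theorem exists_walk_of_step {n m : (arrowComplex hf).Cover u} {a : Arrow f}
    (h : Cover.Step n a m) : ∃ p : Θ.Walk n.pr m.pr, Lifts p n m := by
  have h1 := h.src
  have h2 := h.tgt
  cases a with
  | edge hxy =>
    obtain rfl : _ = n.pr := h1
    obtain rfl : _ = m.pr := h2
    exact ⟨.cons hxy .nil, m, h, rfl⟩
  | diag y z hne hr hna =>
    have h1' : n.pr = f y := h1.symm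
    have h2' : m.pr = f z := h2.symm
    obtain ⟨c⟩ := hr
    obtain ⟨r, hr, ⟨e, -⟩ | ⟨b, hb, hs⟩⟩ := exists_lifts_map c h1' (Or.inl ⟨rfl, rfl⟩)
    · exact absurd e.symm hne
    · rw [hb.eq (.diag y z hne c.reachable hna)] at hs
      obtain rfl := hs.unique h
      rw [h1', h2']
      exact ⟨_, hr⟩

theorem exists_walk_of_root (n : (arrowComplex hf).Cover u) :
    ∃ p : Θ.Walk u n.pr, Lifts p Cover.root n := by
  obtain ⟨k, hk⟩ : ∃ k, n.1 = k := ⟨_, rfl⟩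
  induction k generalizing n with
  | zero =>
    obtain rfl := Cover.eq_root hk
    exact ⟨.nil, rfl⟩
  | succ k ih =>
    obtain ⟨a, m, h, hm⟩ := Cover.exists_down n (by omega)
    obtain ⟨p, hp⟩ := ih m (by omega)
    obtain ⟨q, hq⟩ := exists_walk_of_step h.symm
    exact ⟨p.append q, lifts_append.2 ⟨m, hp, hq⟩⟩

end Transport

/-- Two points of the cover over the same vertex are the ends of lifts of two paths from `u`. The
loop formed by these paths is null-homotopic, so its lift is closed and the points coincide.
Surjectivity is connectedness of `Θ`. -/
theorem bijective_pr (hf : LinkGirthSix f) (hX : IsSimplyConnected f) (u : V) :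
    Function.Bijective (Cover.pr : (arrowComplex hf).Cover u → V) := by
  constructor
  · intro n m hnm
    obtain ⟨p, hp⟩ := exists_walk_of_root n
    obtain ⟨q, hq⟩ : ∃ q : Θ.Walk u n.pr, Lifts q Cover.root m := by
      rw [hnm]
      exact exists_walk_of_root m
    have h := (lifts_iff_of_homotopic (hf := hf) (u := u) (hX.2 u (p.append q.reverse))
      (n := Cover.root) (m := Cover.root) rfl).2 rfl
    obtain ⟨r, hr, hr'⟩ := lifts_append.1 h
    obtain rfl := hp.unique hr
    have := hr'.reverse
    rw [Walk.reverse_reverse] at this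
    exact this.unique hq
  · intro v
    obtain ⟨p⟩ := hX.1.preconnected u v
    obtain ⟨m, hm⟩ := exists_lifts (hf := hf) (u := u) p (n := Cover.root) rfl
    exact ⟨m, hm.pr_eq rfl⟩

theorem isThinSystolic_thickGraph (hf : LinkGirthSix f) (hX : IsSimplyConnected f) :
    (thickGraph f).IsThinSystolic := by
  have := hX.1.nonempty
  rw [← graph_arrowComplex hf]
  exact isThinSystolic_graph (bijective_pr hf hX)

end Graphical

/-! ### Immersed cycles with a prescribed turn -/

namespace SimpleGraph

variable {W : Type*} {Ω : SimpleGraph W}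

/-- The first `m` steps of a sequence of vertices form a path without backtracks. -/
def IsNonbacktracking (Ω : SimpleGraph W) (γ : ℕ → W) (m : ℕ) : Prop :=
  (∀ j < m, Ω.Adj (γ j) (γ (j + 1))) ∧ ∀ j, j + 2 ≤ m → γ j ≠ γ (j + 2)

/-- A bi-infinite periodic path without backtracks. -/
structure IsPeriodicImmersion (Ω : SimpleGraph W) (g : ℤ → W) (M : ℕ) : Prop where
  pos : 0 < M
  periodic : ∀ j, g (j + M) = g j
  adj : ∀ j, Ω.Adj (g j) (g (j + 1))
  ne : ∀ j, g j ≠ g (j + 2)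

namespace IsPeriodicImmersion

variable {g : ℤ → W} {M : ℕ}

theorem shift (h : Ω.IsPeriodicImmersion g M) (k : ℤ) :
    Ω.IsPeriodicImmersion (fun j => g (j + k)) M where
  pos := h.pos
  periodic j := by
    rw [add_right_comm]
    exact h.periodic _
  adj j := by
    rw [add_right_comm]
    exact h.adj _
  ne j := by
    rw [add_right_comm]
    exact h.ne _

theorem reverse (h : Ω.IsPeriodicImmersion g M) :
    Ω.IsPeriodicImmersion (fun j => g (-j)) M where
  pos := h.pos
  periodic j := by
    rw [← h.periodic]
    congr 1
    ring
  adj j := by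
    have := (h.adj (-(j + 1))).symm
    rwa [show -(j + 1) + 1 = -j by ring] at this
  ne j := by
    have := (h.ne (-(j + 2))).symm
    rwa [show -(j + 2) + 2 = -j by ring] at this

theorem mul (h : Ω.IsPeriodicImmersion g M) {k : ℕ} (hk : 0 < k) :
    Ω.IsPeriodicImmersion g (M * k) where
  pos := Nat.mul_pos h.pos hk
  periodic := by
    clear hk
    induction k with
    | zero => simp
    | succ k ih =>
      intro j
      rw [Nat.mul_succ, Nat.cast_add, ← add_assoc, h.periodic, ih]
  adj := h.adj
  ne := h.ne

theorem three_le (h : Ω.IsPeriodicImmersion g M) : 3 ≤ M := by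
  have h0 := h.pos
  have h1 : M ≠ 1 := by
    rintro rfl
    exact (h.adj 0).ne (by simpa using (h.periodic 0).symm)
  have h2 : M ≠ 2 := by
    rintro rfl
    exact h.ne 0 (by simpa using (h.periodic 0).symm)
  omega

end IsPeriodicImmersion

theorem IsNonbacktracking.exists_periodic {γ : ℕ → W} {m : ℕ} (h : Ω.IsNonbacktracking γ m)
    (hm : 0 < m) (hc : γ 0 = γ m) (hne : γ 1 ≠ γ (m - 1)) :
    ∃ g, Ω.IsPeriodicImmersion g m ∧ ∀ j ≤ m, g (j : ℕ) = γ j := by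
  have hm2 : 2 ≤ m := by
    by_contra hlt
    obtain rfl : m = 1 := by omega
    exact (h.1 0 Nat.one_pos).ne hc
  have hmz : (0 : ℤ) < m := by exact_mod_cast hm
  let g : ℤ → W := fun j => γ (j % m).toNat
  have hg : ∀ (j : ℤ) (k : ℕ), k ≤ m → j % m = (k : ℤ) % m → g j = γ k := by
    intro j k hk hj
    simp only [g, hj]
    rcases hk.eq_or_lt with rfl | hk
    · rw [Int.emod_self]
      exact hc
    · rw [Int.emod_eq_of_lt (by positivity) (by exact_mod_cast hk), Int.toNat_natCast]
  have hr : ∀ j : ℤ, ∃ r : ℕ, r < m ∧ j % m = r ∧ ∃ q, j = r + m * q := by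
    intro j
    refine ⟨(j % m).toNat, ?_, ?_, j / m, ?_⟩
    · have := Int.emod_lt_of_pos j hmz
      have := Int.emod_nonneg j hmz.ne'
      omega
    · rw [Int.toNat_of_nonneg (Int.emod_nonneg j hmz.ne')]
    · rw [Int.toNat_of_nonneg (Int.emod_nonneg j hmz.ne'), Int.emod_add_mul_ediv]
  refine ⟨g, ⟨hm, ?_, ?_, ?_⟩, fun j hj => hg j j hj rfl⟩
  · intro j
    simp only [g, Int.add_emod_right]
  · intro j
    obtain ⟨r, hrm, -, q, rfl⟩ := hr j
    rw [hg _ r hrm.le (by simp), hg _ (r + 1) hrm (by push_cast; rw [add_right_comm]; simp)]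
    exact h.1 r hrm
  · intro j
    obtain ⟨r, hrm, -, q, rfl⟩ := hr j
    rw [hg _ r hrm.le (by simp)]
    by_cases h2 : r + 2 ≤ m
    · rw [hg _ (r + 2) h2 (by push_cast; rw [add_right_comm]; simp)]
      exact h.2 r h2
    · obtain rfl : m = r + 1 := by omega
      rw [hg _ 1 (by omega) (by
        rw [show (r : ℤ) + ((r + 1 : ℕ) : ℤ) * q + 2 = (1 : ℕ) + ((r + 1 : ℕ) : ℤ) * (q + 1) by
          push_cast; ring]
        simp)]
      exact hne.symm

/-- Two closed paths without backtracks, the first arriving at `y` from `z` and the second leaving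
`y` towards `z'`, yield a cyclically reduced path that makes the turn from `z` over `y` to `z'`. -/
theorem exists_turn {y z z' : W} (hz : z ≠ z') : ∀ (N p q : ℕ) (α β : ℕ → W), p + q ≤ N → 0 < p →
    0 < q → Ω.IsNonbacktracking α p → Ω.IsNonbacktracking β q → α 0 = y → α p = y →
    α (p - 1) = z → β 0 = y → β q = y → β 1 = z' →
    ∃ g M, Ω.IsPeriodicImmersion g M ∧ g (-1) = z ∧ g 0 = y ∧ g 1 = z' := by
  intro N
  induction N with
  | zero => intros; omega
  | succ N ih =>
    intro p q α β hN hp hq hα hβ α0 αp αz β0 βq βz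
    -- The concatenation of `α` and `β`. It does not backtrack at the middle because `z ≠ z'`, but
    -- it may backtrack where it closes up.
    let γ : ℕ → W := fun j => if j ≤ p then α j else β (j - p)
    have γ1 : ∀ j ≤ p, γ j = α j := fun j hj => if_pos hj
    have γ2 : ∀ j, γ (p + j) = β j := by
      intro j
      rcases Nat.eq_zero_or_pos j with rfl | hj
      · rw [Nat.add_zero, γ1 _ le_rfl, αp, β0]
      · simp only [γ]
        rw [if_neg (by omega), Nat.add_sub_cancel_left]
    have hγ : Ω.IsNonbacktracking γ (p + q) := by
      constructor
      · intro j hj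
        rcases lt_or_ge j p with h | h
        · rw [γ1 j h.le, γ1 (j + 1) h]
          exact hα.1 j h
        · obtain ⟨i, rfl⟩ := Nat.exists_eq_add_of_le h
          rw [add_assoc, γ2, γ2]
          exact hβ.1 i (by omega)
      · intro j hj
        rcases le_or_gt (j + 2) p with h | h
        · rw [γ1 j (by omega), γ1 (j + 2) h]
          exact hα.2 j h
        rcases lt_or_ge j p with h' | h'
        · obtain rfl : p = j + 1 := by omega
          rw [γ1 j (by omega), show j + 2 = j + 1 + 1 from rfl, γ2, βz]
          rw [Nat.add_sub_cancel] at αz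
          rwa [αz]
        · obtain ⟨i, rfl⟩ := Nat.exists_eq_add_of_le h'
          rw [add_assoc, γ2, γ2]
          exact hβ.2 i (by omega)
    -- Here `t` is the number of edges that cancel at the closing point. If cancellation stops while
    -- `t` is smaller than `p` and `q`, cutting off `t` edges at either end leaves a cyclically
    -- reduced path that still passes the turn, now at time `p - t`.
    by_cases hex : ∃ t, t < p ∧ t < q ∧ γ t = γ (p + q - t) ∧ γ (t + 1) ≠ γ (p + q - t - 1)
    · obtain ⟨t, htp, htq, h1, h2⟩ := hex
      have hδ : Ω.IsNonbacktracking (fun j => γ (t + j)) (p + q - 2 * t) :=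
        ⟨fun j hj => hγ.1 (t + j) (by omega), fun j hj => hγ.2 (t + j) (by omega)⟩
      obtain ⟨g, hg, hgγ⟩ := hδ.exists_periodic (by omega)
        (by rw [Nat.add_zero, h1]; congr 1; omega)
        (by rwa [show t + (p + q - 2 * t - 1) = p + q - t - 1 by omega])
      refine ⟨_, _, hg.shift (p - t : ℕ), ?_, ?_, ?_⟩
      · have := hgγ (p - t - 1) (by omega)
        rw [show (-1 + ((p - t : ℕ) : ℤ)) = ((p - t - 1 : ℕ) : ℤ) by omega, this,
          show t + (p - t - 1) = p - 1 by omega, γ1 _ (by omega), αz]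
      · have := hgγ (p - t) (by omega)
        rw [show (0 + ((p - t : ℕ) : ℤ)) = ((p - t : ℕ) : ℤ) by omega, this,
          show t + (p - t) = p by omega, γ1 _ le_rfl, αp]
      · have := hgγ (p - t + 1) (by omega)
        rw [show (1 + ((p - t : ℕ) : ℤ)) = ((p - t + 1 : ℕ) : ℤ) by omega, this,
          show t + (p - t + 1) = p + 1 by omega, γ2, βz]
    · push Not at hex
      have hall : ∀ t, t ≤ p → t ≤ q → γ t = γ (p + q - t) := by
        intro t
        induction t with
        | zero =>
          intro _ _
          rw [γ1 0 hp.le, α0, Nat.sub_zero, γ2, βq]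
        | succ t iht =>
          intro h1 h2
          rw [hex t h1 h2 (iht (by omega) (by omega))]
          congr 1
      -- The shorter of the two paths cancels completely. Thus the longer one passes `y` at an
      -- intermediate time and can be shortened to a closed path that keeps its edge at the turn;
      -- equal lengths would give `z = z'`.
      rcases lt_trichotomy p q with h | rfl | h
      · refine ih p (q - p) α β (by omega) hp (by omega) hα
          ⟨fun j hj => hβ.1 j (by omega), fun j hj => hβ.2 j (by omega)⟩ α0 αp αz β0 ?_ βz
        have := hall p le_rfl h.le
        rw [γ1 p le_rfl, αp, show p + q - p = p + (q - p) by omega, γ2] at this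
        exact this.symm
      · exfalso
        have := hall (p - 1) (by omega) (by omega)
        rw [γ1 _ (by omega), αz, show p + p - (p - 1) = p + 1 by omega, γ2, βz] at this
        exact hz this
      · refine ih (p - q) q (fun j => α (q + j)) β (by omega) (by omega) hq
          ⟨fun j hj => hα.1 (q + j) (by omega), fun j hj => hα.2 (q + j) (by omega)⟩ hβ ?_
          ?_ ?_ β0 βq βz
        · have := hall q h.le le_rfl
          rw [γ1 q h.le, Nat.add_sub_cancel, γ1 p le_rfl, αp] at this
          exact this
        · rwa [show q + (p - q) = p by omega]
        · rwa [show q + (p - q - 1) = p - 1 by omega]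

end SimpleGraph

namespace Graphical

open SimpleGraph

variable {W : Type*} {Ω : SimpleGraph W}

theorem IsImmersed.isNonbacktracking {u v : W} {p : Ω.Walk u v} (h : IsImmersed p) :
    Ω.IsNonbacktracking p.getVert p.length := by
  refine ⟨fun j hj => p.adj_getVert_succ hj, fun j hj he => ?_⟩
  have hl := p.length_darts
  have := (List.isChain_iff_getElem.1 h) j (by omega)
  apply this
  rw [Walk.darts_getElem_eq_getVert, Walk.darts_getElem_eq_getVert]
  ext
  · rfl
  · exact he.symm

theorem IsImmersedCycle.exists_periodic {w : W} {c : Ω.Walk w w} (h : IsImmersedCycle c) :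
    ∃ g, Ω.IsPeriodicImmersion g c.length ∧ ∀ j ≤ c.length, g (j : ℕ) = c.getVert j := by
  obtain ⟨h0, h⟩ := h
  have h' := h.isNonbacktracking
  rw [Walk.length_append] at h'
  have h1 : ∀ j, j ≤ c.length → (c.append c).getVert j = c.getVert j := by
    intro j hj
    rw [Walk.getVert_append]
    split_ifs with hlt
    · rfl
    · obtain rfl : j = c.length := by omega
      simp
  have hnb : Ω.IsNonbacktracking c.getVert c.length := by
    constructor
    · exact fun j hj => c.adj_getVert_succ hj
    · intro j hj
      rw [← h1 j (by omega), ← h1 (j + 2) hj]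
      exact h'.2 j (by omega)
  refine hnb.exists_periodic h0 (by simp) ?_
  have := h'.2 (c.length - 1) (by omega)
  rw [h1 _ (by omega), Walk.getVert_append, if_neg (by omega),
    show c.length - 1 + 2 - c.length = 1 by omega] at this
  exact this.symm

theorem exists_periodic_of_adj
    (hΩ : ∀ a b : W, Ω.Adj a b → ∃ (w : W) (c : Ω.Walk w w), IsImmersedCycle c ∧ s(a, b) ∈ c.edges)
    {a b : W} (hab : Ω.Adj a b) : ∃ g M, Ω.IsPeriodicImmersion g M ∧ g 0 = a ∧ g 1 = b := by
  obtain ⟨w, c, hc, he⟩ := hΩ a b hab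
  obtain ⟨g, hg, hgc⟩ := hc.exists_periodic
  obtain ⟨j, hj, hj'⟩ := List.getElem_of_mem he
  rw [Walk.length_edges] at hj
  have hjv : s(g (j : ℕ), g (j + 1 : ℕ)) = s(a, b) := by
    rw [hgc j hj.le, hgc (j + 1) hj, ← hj']
    simp [Walk.edges, Walk.darts_getElem_eq_getVert]
  rcases Sym2.eq_iff.1 hjv with ⟨h1, h2⟩ | ⟨h1, h2⟩
  · refine ⟨_, _, hg.shift j, by simpa using h1, ?_⟩
    rw [← h2]
    push_cast
    rw [add_comm]
  · refine ⟨_, _, (hg.shift (j + 1)).reverse, ?_, by simpa using h1⟩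
    rw [← h2]
    simp

theorem exists_periodic_turn
    (hΩ : ∀ a b : W, Ω.Adj a b → ∃ (w : W) (c : Ω.Walk w w), IsImmersedCycle c ∧ s(a, b) ∈ c.edges)
    {y z z' : W} (h : Ω.Adj y z) (h' : Ω.Adj y z') (hz : z ≠ z') :
    ∃ g M, Ω.IsPeriodicImmersion g M ∧ g (-1) = z ∧ g 0 = y ∧ g 1 = z' := by
  obtain ⟨a, p, ha, a0, a1⟩ := exists_periodic_of_adj hΩ h.symm
  obtain ⟨b, q, hb, b0, b1⟩ := exists_periodic_of_adj hΩ h'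
  -- The shift moves the base point from `z` to `y`, so that the first closed path ends with the
  -- edge from `z` to `y`.
  have ha' := ha.shift 1
  refine exists_turn hz (p + q) p q (fun j => a (j + 1)) (fun j => b j) le_rfl ha.pos hb.pos
    ⟨fun j _ => ?_, fun j _ => ?_⟩ ⟨fun j _ => ?_, fun j _ => ?_⟩ ?_ ?_ ?_ ?_ ?_ ?_
  · exact_mod_cast ha'.adj j
  · exact_mod_cast ha'.ne j
  · exact_mod_cast hb.adj j
  · exact_mod_cast hb.ne j
  · simpa using a1
  · rw [add_comm, ha.periodic, a1]
  · rw [Nat.cast_sub (Nat.succ_le_of_lt ha.pos), Nat.cast_one, sub_add_cancel, ← zero_add (p : ℤ),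
      ha.periodic, a0]
  · simpa using b0
  · simpa [b0] using hb.periodic 0
  · simpa using b1

end Graphical

/-- An invariant `cls` classifies the orbits as soon as every point lies in the orbit of the
representative of its class. Vertices, edges and faces of the wheel are counted in this way. -/
theorem Equiv.Perm.sameCycle_iff_of_class {α β : Type*} {σ : Equiv.Perm α} {cls : α → β}
    {rep : β → α} (h1 : ∀ a, cls (σ a) = cls a) (h3 : ∀ a, σ.SameCycle (rep (cls a)) a) (a b : α) :
    σ.SameCycle a b ↔ cls a = cls b := by
  constructor
  · have hn : ∀ (n : ℕ) a, cls ((σ ^ n) a) = cls a := by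
      intro n
      induction n with
      | zero => exact fun _ => rfl
      | succ n ih => intro a; rw [pow_succ', Equiv.Perm.mul_apply, h1, ih]
    rintro ⟨n | n, rfl⟩
    · exact (hn n a).symm
    · have := hn (n + 1) ((σ ^ Int.negSucc n) a)
      rw [← Equiv.Perm.mul_apply, zpow_negSucc, mul_inv_cancel] at this
      exact this
  · intro h
    have := h3 a
    rw [h] at this
    exact this.symm.trans (h3 b)

theorem Equiv.Perm.card_sameCycle_of_class {α β : Type*} {σ : Equiv.Perm α} {cls : α → β}
    {rep : β → α} (h1 : ∀ a, cls (σ a) = cls a) (h2 : ∀ b, cls (rep b) = b)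
    (h3 : ∀ a, σ.SameCycle (rep (cls a)) a) :
    Nat.card (Quotient (Equiv.Perm.SameCycle.setoid σ)) = Nat.card β := by
  have hs := sameCycle_iff_of_class h1 h3
  refine Nat.card_congr ⟨Quotient.lift cls fun a b h => (hs a b).1 h,
    fun b => Quotient.mk _ (rep b), ?_, h2⟩
  intro q
  induction q using Quotient.ind with
  | _ a => exact Quotient.sound (h3 a)

/-! ### The wheel as a disc diagram -/

namespace Graphical

/-- The darts of the wheel, a disc consisting of `n` faces with `m + 3` edges each around a vertex:
`(i, j, true)` is the `j`-th dart of the `i`-th face, where the darts `0` of the faces start at the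
centre; the last dart of the face `i + 1` is the reverse `(i, 0, false)` of the dart `0` of the
face `i`. -/
abbrev WheelDart (n m : ℕ) : Type := ZMod n × Fin (m + 2) × Bool

namespace WheelDart

variable {n m : ℕ}

/-- Reversal of darts. -/
def opp (d : WheelDart n m) : WheelDart n m := (d.1, d.2.1, !d.2.2)

theorem opp_opp (d : WheelDart n m) : opp (opp d) = d := by
  simp [opp]

/-- The next dart on the boundary of a face. -/
def next : WheelDart n m → WheelDart n m
  | (i, j, true) => if h : j.1 < m + 1 then (i, ⟨j.1 + 1, by omega⟩, true) else (i - 1, 0, false)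
  | (i, j, false) => if j.1 = 0 then (i + 1, 0, true)
      -- The darts `(i, j, false)` with `j` positive bound the outer face, which is traversed with
      -- decreasing `j`; after `j = 1` it continues along the face `i + 1`.
      else if j.1 = 1 then (i + 1, Fin.last _, false)
      else (i, ⟨j.1 - 1, by omega⟩, false)

theorem next_injective : Function.Injective (next : WheelDart n m → WheelDart n m) := by
  rintro ⟨i, ⟨j, hj⟩, b⟩ ⟨i', ⟨j', hj'⟩, b'⟩ h
  cases b <;> cases b' <;> simp only [next] at h <;> split_ifs at h <;>
    simp only [Prod.mk.injEq, Fin.ext_iff, Fin.val_last, Fin.val_zero, and_true, and_false,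
      reduceCtorEq, add_left_inj, sub_left_inj] at h ⊢ <;>
    first
      | exact ⟨h.1, by omega⟩
      | exact ⟨h, by omega⟩
      | omega

/-- The face of a dart; the outer face is `none`. -/
def face : WheelDart n m → Option (ZMod n)
  | (i, _, true) => some i
  | (i, j, false) => if j.1 = 0 then some (i + 1) else none

/-- The initial vertex of a dart; the centre is `none`. -/
def vertex : WheelDart n m → Option (ZMod n × Fin (m + 1))
  | (i, j, true) => if j.1 = 0 then none else some (i, ⟨j.1 - 1, by omega⟩)
  | (i, j, false) => if h : j.1 < m + 1 then some (i, ⟨j.1, h⟩) else some (i - 1, 0)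

theorem face_next (d : WheelDart n m) : face (next d) = face d := by
  obtain ⟨i, ⟨j, hj⟩, b⟩ := d
  cases b <;> simp only [next] <;> split_ifs <;> simp_all [face]
  omega

theorem vertex_next_opp (d : WheelDart n m) : vertex (next (opp d)) = vertex d := by
  obtain ⟨i, ⟨j, hj⟩, b⟩ := d
  cases b <;> simp only [next, opp, Bool.not_true, Bool.not_false] <;> split_ifs <;>
    simp_all [vertex]
  rw [dif_pos (by omega)]

/-- `next` as a permutation. -/
noncomputable def nextPerm (n m : ℕ) [NeZero n] : Equiv.Perm (WheelDart n m) :=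
  Equiv.ofBijective next (Finite.injective_iff_bijective.1 next_injective)

/-- `opp` as a permutation. -/
def flipPerm (n m : ℕ) : Equiv.Perm (WheelDart n m) :=
  ⟨opp, opp, opp_opp, opp_opp⟩

/-- The rotation around vertices. -/
noncomputable def rotPerm (n m : ℕ) [NeZero n] : Equiv.Perm (WheelDart n m) :=
  nextPerm n m * flipPerm n m

theorem nextPerm_apply [NeZero n] (d : WheelDart n m) : nextPerm n m d = next d := rfl

theorem flipPerm_apply (d : WheelDart n m) : flipPerm n m d = opp d := rfl

theorem rotPerm_apply [NeZero n] (d : WheelDart n m) : rotPerm n m d = next (opp d) := rfl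

theorem rotPerm_mul_flipPerm [NeZero n] : rotPerm n m * flipPerm n m = nextPerm n m := by
  ext1 d
  rw [Equiv.Perm.mul_apply, rotPerm_apply, flipPerm_apply, opp_opp, nextPerm_apply]

theorem sameCycle_apply {α : Type*} (σ : Equiv.Perm α) {a b : α} (h : σ a = b) :
    σ.SameCycle a b := ⟨1, by simpa using h⟩

theorem card_edges :
    Nat.card (Quotient (Equiv.Perm.SameCycle.setoid (flipPerm n m))) = n * (m + 2) := by
  rw [Equiv.Perm.card_sameCycle_of_class (cls := fun d : WheelDart n m => (d.1, d.2.1))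
    (rep := fun x => (x.1, x.2, true)) (fun _ => rfl) (fun _ => rfl) ?_]
  · rw [Nat.card_prod, Nat.card_zmod, Nat.card_fin]
  · rintro ⟨i, j, _ | _⟩
    · exact sameCycle_apply _ rfl
    · exact Equiv.Perm.SameCycle.refl _ _

variable [NeZero n]

theorem sameCycle_center (i : ZMod n) :
    (rotPerm n m).SameCycle ((0, 0, true) : WheelDart n m) (i, 0, true) := by
  rw [← ZMod.natCast_zmod_val i]
  generalize i.val = k
  induction k with
  | zero =>
    rw [Nat.cast_zero]
  | succ k ih =>
    refine ih.trans (sameCycle_apply _ ?_)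
    simp [rotPerm_apply, opp, next]

theorem sameCycle_vertex (d : WheelDart n m) : (rotPerm n m).SameCycle
    (match vertex d with
      | none => (0, 0, true)
      | some (i, j) => (i, j.succ, true)) d := by
  have h1 : ∀ i (j : ℕ) (hj : j < m + 1), (rotPerm n m).SameCycle
      ((i, ⟨j + 1, by omega⟩, true) : WheelDart n m) (i, ⟨j, by omega⟩, false) := by
    intro i j hj
    refine (sameCycle_apply _ ?_).symm
    simp [rotPerm_apply, opp, next, hj]
  obtain ⟨i, ⟨j, hj⟩, b⟩ := d
  cases b
  · simp only [vertex]
    split_ifs with h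
    · exact h1 i j h
    · obtain rfl : j = m + 1 := by omega
      refine (h1 (i - 1) 0 (by omega)).trans (sameCycle_apply _ ?_).symm
      simp [rotPerm_apply, opp, next]
  · simp only [vertex]
    split_ifs with h
    · obtain rfl : j = 0 := h
      exact sameCycle_center i
    · obtain ⟨k, rfl⟩ := Nat.exists_eq_succ_of_ne_zero h
      exact Equiv.Perm.SameCycle.refl _ _

theorem sameCycle_inner_face (i : ZMod n) (j : ℕ) (hj : j < m + 2) :
    (nextPerm n m).SameCycle ((i, 0, true) : WheelDart n m) (i, ⟨j, hj⟩, true) := by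
  induction j with
  | zero => exact Equiv.Perm.SameCycle.refl _ _
  | succ j ih =>
    refine (ih (by omega)).trans (sameCycle_apply _ ?_)
    simp [nextPerm_apply, next, show j < m + 1 by omega]

theorem sameCycle_outer_segment (i : ZMod n) (k : ℕ) (hk : k ≤ m) :
    (nextPerm n m).SameCycle ((i, Fin.last _, false) : WheelDart n m)
      (i, ⟨m + 1 - k, by omega⟩, false) := by
  induction k with
  | zero => exact Equiv.Perm.SameCycle.refl _ _
  | succ k ih =>
    refine (ih (by omega)).trans (sameCycle_apply _ ?_)
    simp only [nextPerm_apply, next]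
    rw [if_neg (by omega), if_neg (by omega)]
    simp only [Prod.mk.injEq, Fin.mk.injEq, and_true, true_and]
    omega

theorem sameCycle_outer_last (i : ZMod n) : (nextPerm n m).SameCycle
    ((0, Fin.last _, false) : WheelDart n m) (i, Fin.last _, false) := by
  rw [← ZMod.natCast_zmod_val i]
  generalize i.val = k
  induction k with
  | zero => rw [Nat.cast_zero]
  | succ k ih =>
    refine (ih.trans (sameCycle_outer_segment _ m le_rfl)).trans (sameCycle_apply _ ?_)
    simp [nextPerm_apply, next]

theorem sameCycle_face (d : WheelDart n m) : (nextPerm n m).SameCycle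
    (match face d with
      | none => (0, Fin.last _, false)
      | some i => (i, 0, true)) d := by
  obtain ⟨i, ⟨j, hj⟩, b⟩ := d
  cases b
  · simp only [face]
    split_ifs with h
    · obtain rfl : j = 0 := h
      refine (sameCycle_apply _ ?_).symm
      simp [nextPerm_apply, next]
    · refine (sameCycle_outer_last i).trans ?_
      have := sameCycle_outer_segment (m := m) i (m + 1 - j) (by omega)
      convert this using 4
      omega
  · exact sameCycle_inner_face i j hj

theorem sameCycle_rot_iff (d e : WheelDart n m) :
    (rotPerm n m).SameCycle d e ↔ vertex d = vertex e :=
  Equiv.Perm.sameCycle_iff_of_class (rep := fun x => match x with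
      | none => (0, 0, true)
      | some (i, j) => (i, j.succ, true)) vertex_next_opp sameCycle_vertex d e

theorem sameCycle_next_iff (d e : WheelDart n m) :
    (nextPerm n m).SameCycle d e ↔ face d = face e :=
  Equiv.Perm.sameCycle_iff_of_class (rep := fun x => match x with
      | none => (0, Fin.last _, false)
      | some i => (i, 0, true)) face_next sameCycle_face d e

theorem card_vertices :
    Nat.card (Quotient (Equiv.Perm.SameCycle.setoid (rotPerm n m))) = n * (m + 1) + 1 := by
  rw [Equiv.Perm.card_sameCycle_of_class (rep := fun x => match x with
      | none => (0, 0, true)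
      | some (i, j) => (i, j.succ, true)) vertex_next_opp ?_ sameCycle_vertex]
  · rw [Finite.card_option, Nat.card_prod, Nat.card_zmod, Nat.card_fin]
  · rintro (_ | ⟨i, j⟩) <;> simp [vertex]

theorem card_faces :
    Nat.card (Quotient (Equiv.Perm.SameCycle.setoid (nextPerm n m))) = n + 1 := by
  rw [Equiv.Perm.card_sameCycle_of_class (rep := fun x => match x with
      | none => (0, Fin.last _, false)
      | some i => (i, 0, true)) face_next ?_ sameCycle_face]
  · rw [Finite.card_option, Nat.card_zmod]
  · rintro (_ | i) <;> simp [face]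

end WheelDart

open WheelDart in
/-- The wheel as a cell structure on the sphere. -/
noncomputable abbrev wheelMap (n m : ℕ) [NeZero n] : SphereMap where
  Dart := WheelDart n m
  finite := inferInstance
  rot := rotPerm n m
  flip := flipPerm n m
  flip_flip := WheelDart.opp_opp
  flip_ne d h := by
    have := congrArg (fun d : WheelDart n m => d.2.2) h
    simp [flipPerm_apply, WheelDart.opp] at this
  connected := by
    let H := Subgroup.closure {rotPerm n m, flipPerm n m}
    have hr : rotPerm n m ∈ H := Subgroup.subset_closure (by simp)
    have hf : flipPerm n m ∈ H := Subgroup.subset_closure (by simp)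
    have hn : nextPerm n m ∈ H := by
      rw [← rotPerm_mul_flipPerm]
      exact mul_mem hr hf
    have hc : ∀ {σ : Equiv.Perm (WheelDart n m)} {d e}, σ ∈ H → σ.SameCycle d e →
        ∃ g ∈ H, g d = e := fun hσ ⟨k, hk⟩ => ⟨_, zpow_mem hσ k, hk⟩
    -- Rotation at the centre reaches every spoke, the boundary of a face is then followed to `(i,
    -- j, true)`, and a final flip reaches the reversed darts.
    have key : ∀ d : WheelDart n m, ∃ g ∈ H, g (0, 0, true) = d := by
      rintro ⟨i, ⟨j, hj⟩, b⟩
      obtain ⟨g, hg, hg'⟩ := hc hr (sameCycle_center (m := m) i)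
      obtain ⟨g', hg2, hg2'⟩ := hc hn (sameCycle_inner_face i j hj)
      cases b
      · refine ⟨flipPerm n m * (g' * g), mul_mem hf (mul_mem hg2 hg), ?_⟩
        rw [Equiv.Perm.mul_apply, Equiv.Perm.mul_apply, hg', hg2']
        rfl
      · refine ⟨g' * g, mul_mem hg2 hg, ?_⟩
        rw [Equiv.Perm.mul_apply, hg', hg2']
    intro d e
    obtain ⟨g, hg, rfl⟩ := key d
    obtain ⟨g', hg', rfl⟩ := key e
    exact ⟨g' * g⁻¹, mul_mem hg' (inv_mem hg), by simp⟩
  euler := by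
    rw [rotPerm_mul_flipPerm, card_vertices, card_faces, card_edges]
    ring

section

variable {V W : Type*} {Θ : SimpleGraph V} {Ω : SimpleGraph W} (f : Ω →g Θ)

/-- Boundary data for the wheel: the boundary paths `g i` of the faces lifted to `Ω`. -/
structure WheelData (n m : ℕ) (g : ZMod n → ℕ → W) (v : V) : Prop where
  adj : ∀ i j, Ω.Adj (g i j) (g i (j + 1))
  ne : ∀ i j, g i j ≠ g i (j + 2)
  periodic : ∀ i j, g i (j + (m + 3)) = g i j
  center : ∀ i, f (g i 0) = v
  spoke : ∀ i, f (g i 1) = f (g (i + 1) (m + 2))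
  reduced : ∀ i, ¬ (g i 0 = g (i + 1) 0 ∧ g i 1 = g (i + 1) (m + 2))

variable {f} {n m : ℕ} {g : ZMod n → ℕ → W} {v : V}

/-- The images of the vertices of the wheel. -/
def wheelVert (f : Ω →g Θ) (g : ZMod n → ℕ → W) : WheelDart n m → V
  | (i, j, true) => f (g i j)
  | (i, j, false) => f (g i (j + 1))

/-- The lifts of the corners of the wheel; on the boundary the value is arbitrary. -/
def wheelLift (g : ZMod n → ℕ → W) : WheelDart n m → W
  | (i, j, true) => g i j
  | (i, _, false) => g (i + 1) (m + 2)

open WheelDart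

theorem vertex_eq_none {d : WheelDart n m} : vertex d = none ↔ ∃ i, d = (i, 0, true) := by
  obtain ⟨i, ⟨j, hj⟩, b⟩ := d
  cases b
  · simp only [vertex]
    split_ifs <;> simp
  · simp only [vertex]
    split_ifs with h
    · simp [h]
    · simp [Fin.ext_iff, h]

/-- `IsCorner i j d`: the dart `d` starts at the `j`-th vertex of the boundary of the face `i`. -/
def IsCorner (i : ZMod n) (j : ℕ) (d : WheelDart n m) : Prop :=
  (∃ h : j < m + 2, d = (i, ⟨j, h⟩, true)) ∨ (j = m + 2 ∧ d = (i - 1, 0, false))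

theorem exists_isCorner {d : WheelDart n m} (h : face d ≠ none) : ∃ i j, IsCorner i j d := by
  obtain ⟨i, ⟨j, hj⟩, b⟩ := d
  cases b
  · simp only [face] at h
    split_ifs at h with h0
    · obtain rfl : j = 0 := h0
      exact ⟨i + 1, m + 2, Or.inr ⟨rfl, by simp⟩⟩
    · exact absurd rfl h
  · exact ⟨i, j, Or.inl ⟨hj, rfl⟩⟩

theorem IsCorner.lift_eq {i : ZMod n} {j : ℕ} {d : WheelDart n m} (h : IsCorner i j d) :
    wheelLift g d = g i j := by
  rcases h with ⟨h, rfl⟩ | ⟨rfl, rfl⟩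
  · rfl
  · simp [wheelLift]

theorem IsCorner.next {i : ZMod n} {j : ℕ} {d : WheelDart n m} (h : IsCorner i j d) :
    IsCorner i (j + 1) (next d) ∨ (j + 1 = m + 3 ∧ IsCorner i 0 (next d)) := by
  rcases h with ⟨h, rfl⟩ | ⟨rfl, rfl⟩
  · left
    by_cases h' : j < m + 1
    · exact Or.inl ⟨by omega, by simp [WheelDart.next, h']⟩
    · exact Or.inr ⟨by omega, by simp [WheelDart.next, h']⟩
  · exact Or.inr ⟨rfl, Or.inl ⟨by omega, by simp [WheelDart.next]⟩⟩

theorem WheelData.lift_next (h : WheelData f n m g v) {i : ZMod n} {j : ℕ} {d : WheelDart n m}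
    (hd : IsCorner i j d) : wheelLift g (next d) = g i (j + 1) := by
  rcases hd.next with h' | ⟨e, h'⟩
  · exact h'.lift_eq
  · rw [h'.lift_eq, e, ← h.periodic, zero_add]

theorem WheelData.lift_next_next (h : WheelData f n m g v) {i : ZMod n} {j : ℕ}
    {d : WheelDart n m} (hd : IsCorner i j d) : wheelLift g (next (next d)) = g i (j + 2) := by
  rcases hd.next with h' | ⟨e, h'⟩
  · exact h.lift_next h'
  · rw [h.lift_next h', show j + 2 = 1 + (m + 3) by omega, h.periodic, zero_add]

variable [NeZero n]

theorem wheelMap_next : (wheelMap n m).next = nextPerm n m := rotPerm_mul_flipPerm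

theorem wheelMap_inner_iff (d : WheelDart n m) :
    ¬ (wheelMap n m).next.SameCycle ((0, Fin.last _, false) : WheelDart n m) d ↔
      face d ≠ none := by
  rw [wheelMap_next, sameCycle_next_iff, eq_comm]
  simp [face]

/-- The wheel as a disc diagram. -/
noncomputable def WheelData.diagram (h : WheelData f n m g v) : DiscDiagram f where
  toSphereMap := wheelMap n m
  outer := ((0, Fin.last _, false) : WheelDart n m)
  vert := wheelVert f g
  lift := wheelLift g
  vert_rot := by
    rintro ⟨i, ⟨j, hj⟩, b⟩
    change wheelVert f g (next (opp _)) = _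
    cases b
    · simp only [next, opp, Bool.not_false]
      split_ifs with h1
      · rfl
      · obtain rfl : j = m + 1 := by omega
        simpa [wheelVert] using h.spoke (i - 1)
    · simp only [next, opp, Bool.not_true]
      split_ifs with h0 h1
      · obtain rfl : j = 0 := h0
        simp [wheelVert, h.center]
      · obtain rfl : j = 1 := h1
        simpa [wheelVert] using (h.spoke i).symm
      · simp only [wheelVert]
        rw [Nat.sub_add_cancel (by omega)]
  vert_adj := by
    rintro ⟨i, j, _ | _⟩
    · exact f.map_adj (h.adj i j).symm
    · exact f.map_adj (h.adj i j)
  map_lift := by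
    rintro ⟨i, ⟨j, hj⟩, b⟩ hd
    cases b
    · rw [wheelMap_inner_iff] at hd
      simp only [face] at hd
      split_ifs at hd with h0
      · obtain rfl : j = 0 := h0
        exact (h.spoke i).symm
      · exact absurd rfl hd
    · rfl
  lift_adj d hd := by
    rw [wheelMap_inner_iff] at hd
    rw [wheelMap_next]
    obtain ⟨i, j, hd⟩ := exists_isCorner hd
    rw [nextPerm_apply, hd.lift_eq, h.lift_next hd]
    exact h.adj i j
  lift_immersed d hd := by
    rw [wheelMap_inner_iff] at hd
    rw [wheelMap_next]
    obtain ⟨i, j, hd⟩ := exists_isCorner hd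
    rw [nextPerm_apply, nextPerm_apply, hd.lift_eq, h.lift_next_next hd]
    exact h.ne i j

/-- Only the spokes have inner faces on both sides, and for them the condition is the field
`reduced`. -/
theorem WheelData.isReduced (h : WheelData f n m g v) : h.diagram.IsReduced := by
  rintro ⟨i, ⟨j, hj⟩, b⟩ h1 h2
  have h1' := (wheelMap_inner_iff _).1 h1
  have h2' : face (opp (i, ⟨j, hj⟩, b)) ≠ none := (wheelMap_inner_iff (opp _)).1 h2
  have hn : h.diagram.next = nextPerm n m := wheelMap_next
  have hj0 : j = 0 := by
    cases b
    · by_contra h0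
      simp [face, h0] at h1'
    · by_contra h0
      simp [face, opp, h0] at h2'
  subst hj0
  have n1 : next ((i, 0, false) : WheelDart n m) = (i + 1, 0, true) := by simp [next]
  have n2 : next ((i, 0, true) : WheelDart n m) = (i, ⟨1, by omega⟩, true) := by simp [next]
  rw [hn]
  cases b
  · change ¬ (wheelLift g (i, 0, false) = wheelLift g (next (i, 0, true)) ∧
      wheelLift g (next (i, 0, false)) = wheelLift g (i, 0, true))
    rw [n1, n2]
    exact fun ⟨e1, e2⟩ => h.reduced i ⟨e2.symm, e1.symm⟩
  · change ¬ (wheelLift g (i, 0, true) = wheelLift g (next (i, 0, false)) ∧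
      wheelLift g (next (i, 0, true)) = wheelLift g (i, 0, false))
    rw [n1, n2]
    exact h.reduced i

/-- The centre is an interior vertex and its degree is the number `n` of faces. -/
theorem WheelData.not_lt_six (h : WheelData f n m g v) (hT : SatisfiesT f 6) (hn : 2 < n) :
    6 ≤ n := by
  have hv : ∀ e : WheelDart n m,
      h.diagram.rot.SameCycle ((0, 0, true) : WheelDart n m) e ↔ ∃ i, e = (i, 0, true) := by
    intro e
    rw [← vertex_eq_none, eq_comm]
    exact sameCycle_rot_iff _ e
  have hdeg : h.diagram.degree ((0, 0, true) : WheelDart n m) = n := by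
    refine (Nat.card_congr (Equiv.ofBijective (fun i : ZMod n =>
      (⟨(i, 0, true), (hv _).2 ⟨i, rfl⟩⟩ :
        {e : WheelDart n m // h.diagram.rot.SameCycle ((0, 0, true) : WheelDart n m) e}))
      ⟨?_, ?_⟩)).symm.trans (Nat.card_zmod n)
    · intro i i' e
      exact congrArg (fun x => x.1.1) e
    · rintro ⟨e, he⟩
      obtain ⟨i, rfl⟩ := (hv e).1 he
      exact ⟨i, rfl⟩
  have := hT h.diagram h.isReduced ((0, 0, true) : WheelDart n m) (by
    intro e he
    obtain ⟨i, rfl⟩ := (hv e).1 he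
    exact (wheelMap_inner_iff _).2 (by simp [face]))
  rw [hdeg] at this
  omega

end

end Graphical

/-! ### From T(6) to links of girth six -/

namespace Graphical

open SimpleGraph

variable {V W : Type*} {Θ : SimpleGraph V} {Ω : SimpleGraph W} {f : Ω →g Θ}

/-- Immersed cycles making the turns from `z i` over `y i` to `z' i` are glued along the spokes to a
wheel with `n` faces; `hs` matches the spokes and `hred` makes the wheel reduced. -/
theorem six_le_of_turns
    (hΩ : ∀ a b : W, Ω.Adj a b → ∃ (w : W) (c : Ω.Walk w w), IsImmersedCycle c ∧ s(a, b) ∈ c.edges)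
    (hT : SatisfiesT f 6) {n : ℕ} [NeZero n] (hn : 2 < n) {y z z' : ZMod n → W} {v : V}
    (hy : ∀ i, f (y i) = v) (hz : ∀ i, Ω.Adj (y i) (z i)) (hz' : ∀ i, Ω.Adj (y i) (z' i))
    (hne : ∀ i, z i ≠ z' i) (hs : ∀ i, f (z' i) = f (z (i + 1)))
    (hred : ∀ i, ¬ (y i = y (i + 1) ∧ z' i = z (i + 1))) : 6 ≤ n := by
  choose g M hg g1 g2 g3 using fun i => exists_periodic_turn hΩ (hz i) (hz' i) (hne i)
  -- All faces of the wheel must have the same number of edges, so each cycle is run through several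
  -- times, up to the common period given by the product.
  obtain ⟨L, hL⟩ : ∃ L, ∀ i, Ω.IsPeriodicImmersion (g i) L := by
    refine ⟨∏ i, M i, fun i => ?_⟩
    obtain ⟨k, hk⟩ := Finset.dvd_prod_of_mem M (Finset.mem_univ i)
    have hpos : 0 < ∏ i, M i := Finset.prod_pos fun i _ => (hg i).pos
    rw [hk] at hpos ⊢
    exact (hg i).mul (Nat.pos_of_mul_pos_left hpos)
  obtain ⟨m, rfl⟩ := Nat.exists_eq_add_of_le' (hL 0).three_le
  have hlast : ∀ i, g i ((m + 2 : ℕ) : ℤ) = z i := by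
    intro i
    rw [← g1 i, ← (hL i).periodic (-1)]
    congr 1
    push_cast
    ring
  have hd : WheelData f n m (fun i j => g i j) v :=
    { adj := fun i j => by exact_mod_cast (hL i).adj j
      ne := fun i j => by exact_mod_cast (hL i).ne j
      periodic := fun i j => by exact_mod_cast (hL i).periodic j
      center := fun i => by simp only [Nat.cast_zero, g2, hy]
      spoke := fun i => by simp only [hlast, Nat.cast_one, g3, hs]
      reduced := fun i => by simpa only [hlast, Nat.cast_one, Nat.cast_zero, g2, g3] using hred i }
  exact hd.not_lt_six hT hn

/-- A closed chain of `n` hyperedges in a link is a cyclic sequence of turns, hence a wheel with `n`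
faces, which `T(6)` excludes for `n` equal to 3, 4 or 5. Shorter chains are run through repeatedly
until their length lies in this range. -/
theorem linkGirthSix
    (hΩ : ∀ a b : W, Ω.Adj a b → ∃ (w : W) (c : Ω.Walk w w), IsImmersedCycle c ∧ s(a, b) ∈ c.edges)
    (hT : SatisfiesT f 6) : LinkGirthSix f := by
  have key : ∀ (n : ℕ) [NeZero n], 2 < n → n < 6 → ∀ (y : ZMod n → W) (s t : ZMod n → V) (v : V),
      (∀ i, f (y i) = v) → (∀ i, y i ≠ y (i + 1)) → (∀ i, s i ≠ t i) → (∀ i, t i = s (i + 1)) →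
      (∀ i, HasLift f (y i) (s i)) → (∀ i, HasLift f (y i) (t i)) → False := by
    intro n _ hn hn' y s t v hy hyy hst hts hs ht
    choose z hz hz1 using hs
    choose z' hz' hz1' using ht
    refine absurd (six_le_of_turns hΩ hT hn hy hz hz' (fun i h => hst i ?_)
      (fun i => ?_) fun i h => hyy i h.1) (by omega)
    · rw [← hz1, ← hz1', h]
    · rw [hz1, hz1', hts]
  have square : ∀ {y₁ y₂ y₃ y₄ r s t p}, f y₁ = f y₂ → f y₂ = f y₃ → f y₃ = f y₄ → y₁ ≠ y₂ →
      y₂ ≠ y₃ → y₃ ≠ y₄ → y₄ ≠ y₁ → r ≠ s → s ≠ t → t ≠ p → p ≠ r →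
      HasLift f y₁ r → HasLift f y₂ r → HasLift f y₂ s → HasLift f y₃ s →
      HasLift f y₃ t → HasLift f y₄ t → HasLift f y₄ p → ¬ HasLift f y₁ p := by
    intro y₁ y₂ y₃ y₄ r s t p e1 e2 e3 n1 n2 n3 n4 m1 m2 m3 m4 h1 h2 h3 h4 h5 h6 h7 h8
    refine key 4 (by omega) (by omega) ![y₁, y₂, y₃, y₄] ![p, r, s, t] ![r, s, t, p] (f y₁)
      ?_ ?_ ?_ ?_ ?_ ?_
    · exact Fin.forall_fin_succ.2 ⟨rfl, by simp [Fin.forall_fin_succ, e1, e2, e3]⟩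
    all_goals intro i; fin_cases i
    exacts [n1, n2, n3, n4, m4, m1, m2, m3, rfl, rfl, rfl, rfl, h8, h2, h4, h6, h1, h3, h5, h7]
  refine ⟨?_, ?_, ?_, square, ?_⟩
  · intro y z z' h h' e
    by_contra hne
    -- Two edges at `y` with the same image give a chain of length one, repeated three times here;
    -- the wheel is reduced because `z ≠ z'`.
    exact absurd (six_le_of_turns hΩ hT (n := 3) (by omega) (y := fun _ => y) (z := fun _ => z)
      (z' := fun _ => z') (v := f y) (fun _ => rfl) (fun _ => h) (fun _ => h') (fun _ => hne)
      (fun _ => e.symm) fun _ h => hne h.2.symm) (by omega)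
  · intro y₁ y₂ s t e n m h1 h2 h3 h4
    -- A bigon run through twice is a square; consecutive vertices are still distinct, and no more
    -- is required.
    exact square e e.symm e n n.symm n n.symm m m.symm m m.symm h1 h2 h4 h3 h1 h2 h4 h3
  · intro y₁ y₂ y₃ r s t e1 e2 n1 n2 n3 m1 m2 m3 h1 h2 h3 h4 h5 h6
    refine key 3 (by omega) (by omega) ![y₁, y₂, y₃] ![t, r, s] ![r, s, t] (f y₁)
      ?_ ?_ ?_ ?_ ?_ ?_
    all_goals intro i; fin_cases i
    exacts [rfl, e1.symm, (e1.trans e2).symm, n1, n2, n3, m3, m1, m2, rfl, rfl, rfl, h6, h2, h4,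
      h1, h3, h5]
  · intro y₁ y₂ y₃ y₄ y₅ r s t p q e1 e2 e3 e4 n1 n2 n3 n4 n5 m1 m2 m3 m4 m5 h1 h2 h3 h4 h5 h6 h7
      h8 h9 h10
    refine key 5 (by omega) (by omega) ![y₁, y₂, y₃, y₄, y₅] ![q, r, s, t, p] ![r, s, t, p, q]
      (f y₁) ?_ ?_ ?_ ?_ ?_ ?_
    all_goals intro i; fin_cases i
    exacts [rfl, e1.symm, (e1.trans e2).symm, (e1.trans (e2.trans e3)).symm,
      (e1.trans (e2.trans (e3.trans e4))).symm, n1, n2, n3, n4, n5, m5, m1, m2, m3, m4, rfl, rfl,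
      rfl, rfl, rfl, h10, h2, h4, h6, h8, h1, h3, h5, h7, h9]

end Graphical

theorem mainTheorem11 {V : Type*} {W : Type*} (Θ : SimpleGraph V) (Ω : SimpleGraph W)
    (f : Ω →g Θ)
    (hΘ : ∀ x : V, ¬ ∃! y : V, Θ.Adj x y)
    (hΩ : ∀ a b : W, Ω.Adj a b →
      ∃ (w : W) (c : Ω.Walk w w), Graphical.IsImmersedCycle c ∧ s(a, b) ∈ c.edges)
    (hX : Graphical.IsSimplyConnected f)
    (hC : Graphical.SatisfiesC f 3) (hT : Graphical.SatisfiesT f 6) :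
    (∀ (u v : V) (k : ℕ), k ≤ (Graphical.thickening f).oneSkeleton.dist u v →
      ((Graphical.thickening f).oneSkeleton.induce
        ((Graphical.thickening f).oneSkeleton.levelSet u v k)).IsSegment) ∧
    (Graphical.thickening f).IsFit := by
  have h := Graphical.isThinSystolic_thickGraph (Graphical.linkGirthSix hΩ hT) hX
  have h1 : (Graphical.thickening f).oneSkeleton = Graphical.thickGraph f :=
    (AbstractSimplicialComplex.isFlag_flagCompletion _).1
  refine ⟨fun u v k hk => ?_, AbstractSimplicialComplex.isFit_flagCompletion h⟩
  rw [h1] at hk ⊢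
  exact h.levelSet_isSegment u v hk
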